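/- Let $d\ge 1$, let $R\subset\mathbb R^d$ be a bounded open set with Lipschitz boundary and outward unit normal $\mathbf n$, and let $D=R\times S^{d-1}$, $\partial D=\partial R\times S^{d-1}$, $\partial D_-=\{(\mathbf r,\mathbf s)\in\partial D:\mathbf s\cdot\mathbf n(\mathbf r)<0\}$. Let $\sigma_s,\sigma_a$ be measurable functions on $R$ and $\sigma_t=\sigma_a+\sigma_s$, where $\sigma_s$ and $\sigma_t$ are essentially bounded, $\sigma_s>0$ a.e. and $\sigma_a\ge c_0$ a.e. for some constant $c_0>0$. Let $\theta:[-1,1]\to\mathbb R$ be measurable and non-negative with $\int_{S^{d-1}}\theta(\mathbf s\cdot\mathbf s')\,d\mathbf s'=1$ for a.e. $\mathbf s\in S^{d-1}$. Let $q\in V_0:=L^2(D)$ and $q_\partial\in L^2(\partial D_-;|\mathbf s\cdot\mathbf n|)$. Write $(\cdot,\cdot)$ for the inner product of $L^2(D)$, $v^\pm(\mathbf r,\mathbf s)=\frac12\big(v(\mathbf r,\mathbf s)\pm v(\mathbf r,-\mathbf s)\big)$, let $V_1$ be the space of all $v\in V_0$ with weak derivative $\mathbf s\cdot\nabla v\in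 V_0$ (gradient in $\mathbf r$) and trace in $L^2(\partial D;|\mathbf s\cdot\mathbf n|)$, and let $W=V_1^+\oplus V_0^-=\{u\in V_0: u^+\in V_1\}$. For $u,v\in W$ put $$t(u,v)=(\mathbf s\cdot\nabla u^+,v^-)-(u^-,\mathbf s\cdot\nabla v^+)+(\sigma_t u,v)+(|\mathbf s\cdot\mathbf n|\,u^+,v^+)_{\partial D},$$ $$s(u,v)=\int_D\sigma_s(\mathbf r)\Big(\int_{S^{d-1}}\theta(\mathbf s\cdot\mathbf s')u(\mathbf r,\mathbf s')\,d\mathbf s'\Big)v(\mathbf r,\mathbf s)\,d(\mathbf r,\mathbf s),\qquad \ell(v)=(q,v)-2(\mathbf s\cdot\mathbf n\,q_\partial,v^+)_{\partial D_-}.$$ Let $\|v\|_{\sigma_t}=\|\sqrt{\sigma_t}\,v\|_{L^2(D)}$. Then: (i) For every $w\in W$ there is a unique $\mathcal R(w)\in W$ with $t(\mathcal R(w),v)=\ell(v)-\big(t(w,v)-s(w,v)\big)$ for all $v\in W$, so that the preconditioned residual operator $\mathcal R:W\to W$ is well defined. Likewise, for every $u_k\in W$ there is a unique $u_{k+1/2}\in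 W$ with $t(u_{k+1/2},v)=s(u_k,v)+\ell(v)$ for all $v\in W$. (ii) For every finite-dimensional subspace $W_N\subset W$ and every $u_{k+1/2}\in W$ (in particular, for every iterate as in (i)), the minimization problem $$\min_{w\in W_N}\|\mathcal R(u_{k+1/2}+w)\|_{\sigma_t}^2$$ has a unique solution in $W_N$. -/

import Mathlib

open MeasureTheory Set Metric
open scoped ENNReal NNReal ContDiff MeasureTheory Topology

noncomputable section

namespace RadiativeTransfer

/-- The Euclidean space `ℝ^d`. -/
abbrev Space (d : ℕ) := EuclideanSpace ℝ (Fin d)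

/-- The unit sphere `S^{d-1}` of `ℝ^d`. -/
abbrev Dir (d : ℕ) := sphere (0 : Space d) 1

/-- The surface measure of the unit sphere. -/
abbrev dirMeasure (d : ℕ) : Measure (Dir d) := (volume : Measure (Space d)).toSphere

variable {d : ℕ}

/-! ### The spatial domain, its boundary and its normal field -/

/-- `R` has a Lipschitz boundary: near each boundary point there is a unit vector `e` and a
Lipschitz function `φ` of the component orthogonal to `e` such that `R` is the set of points
lying strictly below the graph of `φ` in direction `e`. -/
def HasLipschitzBoundary (R : Set (Space d)) : Prop :=
  ∀ x ∈ frontier R, ∃ (e : Space d) (K : ℝ≥0) (φ : Space d → ℝ) (ρ : ℝ),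
    ‖e‖ = 1 ∧ LipschitzWith K φ ∧ 0 < ρ ∧
      ∀ y ∈ ball x ρ, (y ∈ R ↔ inner ℝ e y < φ (y - inner ℝ e y • e))

/-- `ν` is the outward unit normal of `R` at `x`: up to an error `o(|y - x|)`, the points `y`
of `R` near `x` lie on the side `(y - x) ⋅ ν ≤ 0` and those outside `R` on the other side. -/
def IsOutwardNormal (R : Set (Space d)) (x ν : Space d) : Prop :=
  ‖ν‖ = 1 ∧ ∀ ε > (0 : ℝ), ∀ᶠ y in 𝓝 x,
    (y ∈ R → inner ℝ (y - x) ν ≤ ε * ‖y - x‖) ∧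
    (y ∉ R → -(ε * ‖y - x‖) ≤ inner ℝ (y - x) ν)

/-- The `(d-1)`-dimensional surface measure on the boundary of `R`. -/
def surfaceMeasure (R : Set (Space d)) : Measure (Space d) :=
  (μHE[d - 1] : Measure (Space d)).restrict (frontier R)

open Classical in
/-- The outward unit normal field `n` on the boundary of `R`. It is determined almost
everywhere with respect to surface measure, and we choose a measurable version. -/
def normal (R : Set (Space d)) : Space d → Space d :=
  if h : ∃ n : Space d → Space d, Measurable n ∧ ∀ᵐ x ∂(surfaceMeasure R),
      IsOutwardNormal R x (n x)
  then h.choose else 0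

/-- The measure `dr ds` on `D = R × S^{d-1}`. -/
def phaseMeasure (R : Set (Space d)) : Measure (Space d × Dir d) :=
  (volume.restrict R).prod (dirMeasure d)

/-- The (unweighted) product measure on `∂D = ∂R × S^{d-1}`. -/
def bdryMeasure (R : Set (Space d)) : Measure (Space d × Dir d) :=
  (surfaceMeasure R).prod (dirMeasure d)

/-- The function `s ⋅ n` on `∂D`. -/
def sn (R : Set (Space d)) (p : Space d × Dir d) : ℝ :=
  inner ℝ (p.2 : Space d) (normal R p.1)

/-- The weighted measure `|s ⋅ n| dσ(r) ds` on `∂D`. -/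
def wBdryMeasure (R : Set (Space d)) : Measure (Space d × Dir d) :=
  (bdryMeasure R).withDensity fun p => ENNReal.ofReal |sn R p|

/-- The inflow boundary `∂D₋ = {s ⋅ n < 0}`. -/
def inflow (R : Set (Space d)) : Set (Space d × Dir d) := {p | p.1 ∈ frontier R ∧ sn R p < 0}

/-! ### Function spaces -/

/-- `V₀ = L²(D)`. -/
abbrev V0 (R : Set (Space d)) := Lp ℝ 2 (phaseMeasure R)

/-- `L²(∂D; |s ⋅ n|)`. -/
abbrev L2Bdry (R : Set (Space d)) := Lp ℝ 2 (wBdryMeasure R)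

/-- `L²(∂D₋; |s ⋅ n|)`. -/
abbrev L2Inflow (R : Set (Space d)) := Lp ℝ 2 ((wBdryMeasure R).restrict (inflow R))

/-- `g` is the weak directional derivative `s ⋅ ∇v` (gradient in `r` only) of `v` on `D`, and `f`
is the trace of `v` on `∂D`, expressed by the integration by parts formula
`(g, w)_D + (v, s ⋅ ∇w)_D = ∫_{∂D} (s ⋅ n) f w` for all `w` smooth up to the boundary.
Test functions supported inside `R` give the weak derivative, and then all others the trace. -/
def IsDerivTrace (R : Set (Space d)) (v : Space d × Dir d → ℝ) (g : V0 R) (f : L2Bdry R) : Prop :=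
  ∀ w : Space d × Space d → ℝ, ContDiff ℝ ∞ w →
    (∫ p, g p * w (p.1, (p.2 : Space d)) ∂(phaseMeasure R))
      + (∫ p, v p * fderiv ℝ w (p.1, (p.2 : Space d)) ((p.2 : Space d), 0) ∂(phaseMeasure R))
    = ∫ p, sn R p * f p * w (p.1, (p.2 : Space d)) ∂(bdryMeasure R)

/-- Membership in `V₁`: the function is in `L²(D)`, its weak derivative `s ⋅ ∇v` is in `L²(D)`
and its trace is in `L²(∂D; |s ⋅ n|)`. -/
def MemV1 (R : Set (Space d)) (v : Space d × Dir d → ℝ) : Prop :=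
  MemLp v 2 (phaseMeasure R) ∧ ∃ (g : V0 R) (f : L2Bdry R), IsDerivTrace R v g f

open Classical in
/-- The weak directional derivative `s ⋅ ∇v` of `v ∈ V₁` (and `0` if `v ∉ V₁`). -/
def sGrad (R : Set (Space d)) (v : Space d × Dir d → ℝ) : V0 R :=
  if h : MemV1 R v then h.2.choose else 0

open Classical in
/-- The trace on `∂D` of `v ∈ V₁` (and `0` if `v ∉ V₁`). -/
def trace (R : Set (Space d)) (v : Space d × Dir d → ℝ) : L2Bdry R :=
  if h : MemV1 R v then h.2.choose_spec.choose else 0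

/-- The even part `v⁺` in the direction variable. -/
def even (v : Space d × Dir d → ℝ) (p : Space d × Dir d) : ℝ := (v p + v (p.1, -p.2)) / 2

/-- The odd part `v⁻` in the direction variable. -/
def odd (v : Space d × Dir d → ℝ) (p : Space d × Dir d) : ℝ := (v p - v (p.1, -p.2)) / 2

/-- The space `W = V₁⁺ ⊕ V₀⁻`: the functions in `V₀` whose even part is in `V₁`. -/
def W (R : Set (Space d)) : Set (V0 R) := {u | MemV1 R (even u)}

/-! ### The variational formulation -/

/-- `(Θ v)(r, s) = ∫ θ(s ⋅ s') v(r, s') ds'`. -/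
def Theta (θ : ℝ → ℝ) (v : Space d × Dir d → ℝ) (p : Space d × Dir d) : ℝ :=
  ∫ s', θ (inner ℝ (p.2 : Space d) (s' : Space d)) * v (p.1, s') ∂(dirMeasure d)

/-- The transport bilinear form
`t(u,v) = (s⋅∇u⁺, v⁻) - (u⁻, s⋅∇v⁺) + (σ_t u, v) + (|s⋅n| u⁺, v⁺)_{∂D}`. -/
def tForm (R : Set (Space d)) (σt : Space d → ℝ) (u v : V0 R) : ℝ :=
  (∫ p, sGrad R (even u) p * odd v p ∂(phaseMeasure R))
    - (∫ p, odd u p * sGrad R (even v) p ∂(phaseMeasure R))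
    + (∫ p, σt p.1 * u p * v p ∂(phaseMeasure R))
    + ∫ p, |sn R p| * trace R (even u) p * trace R (even v) p ∂(bdryMeasure R)

/-- The scattering bilinear form `s(u,v) = (σ_s Θ u, v)`. -/
def sForm (R : Set (Space d)) (σs : Space d → ℝ) (θ : ℝ → ℝ) (u v : V0 R) : ℝ :=
  ∫ p, σs p.1 * Theta θ u p * v p ∂(phaseMeasure R)

/-- The linear form `ℓ(v) = (q, v) - 2 (s⋅n q_∂, v⁺)_{∂D₋}`. -/
def ell (R : Set (Space d)) (q : V0 R) (qb : L2Inflow R) (v : V0 R) : ℝ :=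
  (∫ p, q p * v p ∂(phaseMeasure R))
    - 2 * ∫ p in inflow R, sn R p * qb p * trace R (even v) p ∂(bdryMeasure R)

/-- The residual functional `v ↦ ℓ(v) - (t(w,v) - s(w,v))`. -/
def residual (R : Set (Space d)) (σs σt : Space d → ℝ) (θ : ℝ → ℝ) (q : V0 R) (qb : L2Inflow R)
    (w v : V0 R) : ℝ :=
  ell R q qb v - (tForm R σt w v - sForm R σs θ w v)

/-- `r ∈ W` solves the transport problem `t(r, v) = residual(w)(v)` for all `v ∈ W`. -/
def IsPrecResidual (R : Set (Space d)) (σs σt : Space d → ℝ) (θ : ℝ → ℝ) (q : V0 R)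
    (qb : L2Inflow R) (w r : V0 R) : Prop :=
  r ∈ W R ∧ ∀ v ∈ W R, tForm R σt r v = residual R σs σt θ q qb w v

open Classical in
/-- The preconditioned residual operator: the solution `r ∈ W` of the transport problem
`t(r, v) = residual(w)(v)` for all `v ∈ W`. -/
def precResidual (R : Set (Space d)) (σs σt : Space d → ℝ) (θ : ℝ → ℝ) (q : V0 R)
    (qb : L2Inflow R) (w : V0 R) : V0 R :=
  if h : ∃ r, IsPrecResidual R σs σt θ q qb w r then h.choose else 0

/-- `u'` is obtained from `u` by a source iteration step: `t(u', v) = s(u, v) + ℓ(v)` for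
all `v ∈ W`. -/
def IsHalfStep (R : Set (Space d)) (σs σt : Space d → ℝ) (θ : ℝ → ℝ) (q : V0 R)
    (qb : L2Inflow R) (u u' : V0 R) : Prop :=
  u' ∈ W R ∧ ∀ v ∈ W R, tForm R σt u' v = sForm R σs θ u v + ell R q qb v

/-- The weighted norm `‖v‖_{σ_t} = ‖√σ_t v‖_{L²(D)}`. -/
def wNorm (R : Set (Space d)) (σt : Space d → ℝ) (v : V0 R) : ℝ :=
  Real.sqrt (∫ p, (Real.sqrt (σt p.1) * v p) ^ 2 ∂(phaseMeasure R))

end RadiativeTransfer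

end

/-!
The transport problem is reduced to the even-parity equation. The form `t` controls only
`‖u‖_{L²(D)}` and the trace of `u⁺`, not `s ⋅ ∇u⁺`, so it is not coercive on `W`. But testing with
odd functions determines `u⁻ = σ_t⁻¹ (a⁻ - s ⋅ ∇u⁺)` (`s ⋅ ∇u⁺` is odd because `u⁺` is even), and
inserting this into the equation for even test functions leaves
`(σ_t⁻¹ s⋅∇u⁺, s⋅∇v) + (σ_t u⁺, v) + (|s⋅n| u⁺, v)_{∂D}`, which is coercive in the graph norm of
`V₁⁺`. The Lax-Milgram theorem applies on the graph of `v ↦ (s⋅∇v, trace v)`, a closed subspace of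
`L²(D) × L²(D) × L²(∂D; |s⋅n|)` (`exists_solves`, `isClosed_evenGraph`). Uniqueness follows from
`t(u, u) ≥ (σ_t u, u)`, since the two derivative terms cancel.

To apply this to the given forms one needs that derivative and trace are determined by the
integration by parts formula (`IsDerivTrace.unique`). Test functions supported inside `R` determine
the derivative; the remaining ones then determine the trace, because the surface measure of a
compact Lipschitz boundary is finite (`isFiniteMeasure_surfaceMeasure`) and integrals against test
functions determine integrable functions with respect to any measure. The normal field enters only
through its measurability and `|n| ≤ 1`, which bound the weight `|s⋅n|`.

The scattering form is bounded by `σ_s` (`exists_scattering_operator`): by the normalization and the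
symmetry of `θ(s⋅s')`, both marginals of the measure `θ(s⋅s') dr ds ds'` are `dr ds`, so that
`(σ_s Θ u, u)` is an inner product of two functions of norm `‖√σ_s u‖` in its `L²` space.

With `L` the solution operator of `t(L a, v) = (a, v)` and `K = σ_s Θ`, the preconditioned residual
is affine, with linear part `w ↦ L K w - w`. If `L K w = w`, then `t(w, w) = (K w, w)`, hence
`(σ_t w, w) ≤ (σ_s w, w)` and `c₀ ‖w‖² ≤ 0`. The minimization is therefore a least squares problem
with an injective linear map on a finite-dimensional space
(`existsUnique_forall_norm_add_le`).
-/

namespace RadiativeTransfer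

/-! ### Even-parity reduction in Hilbert space -/

section Abstract

variable {H B : Type*} [NormedAddCommGroup H] [InnerProductSpace ℝ H]
  [NormedAddCommGroup B] [InnerProductSpace ℝ B]

/-- The Hilbert sum `H ⊕ H ⊕ B`, whose elements stand for triples (even function, its directional
derivative, its trace). -/
abbrev Triple (H B : Type*) := WithLp 2 (H × WithLp 2 (H × B))

/-- The even part of `u` with respect to an involution `ρ`. -/
noncomputable def evenPart (ρ : H →L[ℝ] H) (u : H) : H := (2⁻¹ : ℝ) • (u + ρ u)

/-- The odd part of `u` with respect to an involution `ρ`. -/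
noncomputable def oddPart (ρ : H →L[ℝ] H) (u : H) : H := (2⁻¹ : ℝ) • (u - ρ u)

/-- The Lax-Milgram theorem for a form `(S p₁ x, p₁ y) + (T p₂ x, p₂ y) + (p₃ x, p₃ y)` on a Hilbert
space normed by its three components. -/
theorem exists_variational_of_norm_sq_eq {V : Type*} [NormedAddCommGroup V]
    [InnerProductSpace ℝ V] [CompleteSpace V]
    (p₁ p₂ : V →L[ℝ] H) (p₃ : V →L[ℝ] B)
    (hn : ∀ x, ‖x‖ ^ 2 = ‖p₁ x‖ ^ 2 + ‖p₂ x‖ ^ 2 + ‖p₃ x‖ ^ 2)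
    (S T : H →L[ℝ] H) {c c' : ℝ} (hc : 0 < c) (hc' : 0 < c')
    (hS : ∀ u, c * ‖u‖ ^ 2 ≤ inner ℝ (S u) u) (hT : ∀ u, c' * ‖u‖ ^ 2 ≤ inner ℝ (T u) u)
    (a e : H) (b : B) :
    ∃ x, ∀ y, inner ℝ (S (p₁ x)) (p₁ y) + inner ℝ (T (p₂ x)) (p₂ y) + inner ℝ (p₃ x) (p₃ y)
      = inner ℝ a (p₁ y) + inner ℝ e (p₂ y) + inner ℝ b (p₃ y) := by
  let iH := (isBoundedBilinearMap_inner (𝕜 := ℝ) (E := H)).toContinuousLinearMap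
  let iB := (isBoundedBilinearMap_inner (𝕜 := ℝ) (E := B)).toContinuousLinearMap
  let Φ : V →L[ℝ] V →L[ℝ] ℝ :=
    iH.bilinearComp (S ∘L p₁) p₁ + iH.bilinearComp (T ∘L p₂) p₂ + iB.bilinearComp p₃ p₃
  have hΦ : ∀ x y, Φ x y = inner ℝ (S (p₁ x)) (p₁ y) + inner ℝ (T (p₂ x)) (p₂ y)
      + inner ℝ (p₃ x) (p₃ y) := fun x y => rfl
  have hco : IsCoercive Φ := by
    refine ⟨min 1 (min c c'), by positivity, fun x => ?_⟩
    have h1 : min 1 (min c c') ≤ c := (min_le_right _ _).trans (min_le_left _ _)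
    have h2 : min 1 (min c c') ≤ c' := (min_le_right _ _).trans (min_le_right _ _)
    have h3 : min 1 (min c c') ≤ 1 := min_le_left _ _
    rw [hΦ, real_inner_self_eq_norm_sq, mul_assoc, ← sq, hn]
    linarith [hS (p₁ x), hT (p₂ x), mul_le_mul_of_nonneg_right h1 (sq_nonneg ‖p₁ x‖),
      mul_le_mul_of_nonneg_right h2 (sq_nonneg ‖p₂ x‖),
      mul_le_mul_of_nonneg_right h3 (sq_nonneg ‖p₃ x‖)]
  let F : StrongDual ℝ V := innerSL ℝ a ∘L p₁ + innerSL ℝ e ∘L p₂ + innerSL ℝ b ∘L p₃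
  refine ⟨hco.continuousLinearEquivOfBilin.symm ((InnerProductSpace.toDual ℝ V).symm F),
    fun y => ?_⟩
  rw [← hΦ, ← hco.continuousLinearEquivOfBilin_apply, ContinuousLinearEquiv.apply_symm_apply,
    InnerProductSpace.toDual_symm_apply]
  rfl

/-- The even-parity problem is solvable: on a closed subspace of triples the norm is the graph norm,
in which its form is coercive. -/
theorem exists_graph_variational [CompleteSpace H] [CompleteSpace B]
    {G : Submodule ℝ (Triple H B)} (hG : IsClosed (G : Set (Triple H B)))
    (S T : H →L[ℝ] H) {c c' : ℝ} (hc : 0 < c) (hc' : 0 < c')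
    (hS : ∀ u, c * ‖u‖ ^ 2 ≤ inner ℝ (S u) u) (hT : ∀ u, c' * ‖u‖ ^ 2 ≤ inner ℝ (T u) u)
    (a e : H) (b : B) :
    ∃ x ∈ G, ∀ y ∈ G, inner ℝ (S x.fst) y.fst + inner ℝ (T x.snd.fst) y.snd.fst
        + inner ℝ x.snd.snd y.snd.snd
      = inner ℝ a y.fst + inner ℝ e y.snd.fst + inner ℝ b y.snd.snd := by
  have : CompleteSpace G := hG.completeSpace_coe
  obtain ⟨x, hx⟩ := exists_variational_of_norm_sq_eq (V := G)
    (WithLp.fstL 2 ℝ H (WithLp 2 (H × B)) ∘L G.subtypeL)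
    (WithLp.fstL 2 ℝ H B ∘L WithLp.sndL 2 ℝ H (WithLp 2 (H × B)) ∘L G.subtypeL)
    (WithLp.sndL 2 ℝ H B ∘L WithLp.sndL 2 ℝ H (WithLp 2 (H × B)) ∘L G.subtypeL)
    (fun x => by
      rw [Submodule.coe_norm, WithLp.prod_norm_sq_eq_of_L2, WithLp.prod_norm_sq_eq_of_L2,
        ← add_assoc]
      rfl)
    S T hc hc' hS hT a e b
  exact ⟨x, x.2, fun y hy => hx ⟨y, hy⟩⟩

variable (ρ S : H →L[ℝ] H) (G : Submodule ℝ (Triple H B))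

/-- `u` solves the mixed variational problem `t(u, v) = (a, v) + (b, trace v⁺)` for all `v`, where
the graph `G` consists of the triples (even function, directional derivative, trace). -/
def Solves (a : H) (b : B) (u : H) : Prop :=
  ∃ x ∈ G, x.fst = evenPart ρ u ∧ ∀ y ∈ G, ∀ v, y.fst = evenPart ρ v →
    inner ℝ x.snd.fst (oddPart ρ v) - inner ℝ (oddPart ρ u) y.snd.fst + inner ℝ (S u) v
      + inner ℝ x.snd.snd y.snd.snd = inner ℝ a v + inner ℝ b y.snd.snd

variable {ρ S G}

/-- Elimination of the odd part: the equation for odd `v` gives `u⁻ = T (a⁻ - s⋅∇u⁺)` with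
`T = S⁻¹`, and what remains is a coercive problem for `u⁺`. -/
theorem exists_solves [CompleteSpace H] [CompleteSpace B]
    (hG : IsClosed (G : Set (Triple H B)))
    (hρ : ∀ u, ρ (ρ u) = u) (hρs : ∀ u v, inner ℝ (ρ u) v = inner ℝ u (ρ v))
    (hGρ : ∀ x ∈ G, ρ x.fst = x.fst ∧ ρ x.snd.fst = -x.snd.fst)
    (T : H →L[ℝ] H) {c c' : ℝ} (hc : 0 < c) (hc' : 0 < c')
    (hS : ∀ u, c * ‖u‖ ^ 2 ≤ inner ℝ (S u) u) (hT : ∀ u, c' * ‖u‖ ^ 2 ≤ inner ℝ (T u) u)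
    (hST : ∀ u, S (T u) = u) (hSρ : ∀ u, S (ρ u) = ρ (S u)) (hTρ : ∀ u, T (ρ u) = ρ (T u))
    (a : H) (b : B) : ∃ u, Solves ρ S G a b u := by
  -- the third datum is the contribution of `u⁻ = T (a⁻ - s⋅∇u⁺)` to the even equation
  obtain ⟨x, hx, h⟩ := exists_graph_variational hG S T hc hc' hS hT a (T (oddPart ρ a)) b
  obtain ⟨hx1, hx2⟩ := hGρ x hx
  obtain ⟨z, hz⟩ : ∃ z, z = T (oddPart ρ a - x.snd.fst) := ⟨_, rfl⟩
  have hzρ : ρ z = -z := by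
    rw [hz, ← hTρ, ← map_neg]
    congr 1
    simp only [oddPart, map_sub, map_smul, hρ, hx2]; module
  have he : evenPart ρ (x.fst + z) = x.fst := by
    simp only [evenPart, map_add, hx1, hzρ]; module
  have ho : oddPart ρ (x.fst + z) = z := by
    simp only [oddPart, map_add, hx1, hzρ]; module
  refine ⟨x.fst + z, x, hx, he.symm, fun y hy v hv => ?_⟩
  have h1 := h y hy
  have hSx : inner ℝ (S x.fst) (ρ v) = inner ℝ (S x.fst) v := by
    rw [← hρs, ← hSρ, hx1]
  have hgx : inner ℝ x.snd.fst (ρ v) = - inner ℝ x.snd.fst v := by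
    rw [← hρs, hx2, inner_neg_left]
  rw [ho, map_add, hz, hST]
  rw [hv] at h1
  simp only [evenPart, oddPart, inner_add_left, inner_add_right, inner_sub_left, inner_sub_right,
    inner_smul_left, inner_smul_right, map_sub, map_smul, hSx, hgx, hρs,
    RCLike.conj_to_real] at h1 ⊢
  linarith

theorem Solves.add {a a' : H} {b b' : B} {u u' : H} (h : Solves ρ S G a b u)
    (h' : Solves ρ S G a' b' u') : Solves ρ S G (a + a') (b + b') (u + u') := by
  obtain ⟨x, hx, hxu, h⟩ := h
  obtain ⟨x', hx', hxu', h'⟩ := h'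
  refine ⟨x + x', G.add_mem hx hx', ?_, fun y hy v hv => ?_⟩
  · simp only [WithLp.add_fst, hxu, hxu', evenPart, map_add]; module
  · have := h y hy v hv
    have := h' y hy v hv
    have ho : oddPart ρ (u + u') = oddPart ρ u + oddPart ρ u' := by
      simp only [oddPart, map_add]; module
    simp only [WithLp.add_fst, WithLp.add_snd, inner_add_left, map_add, ho]
    linarith

theorem Solves.smul {a : H} {b : B} {u : H} (r : ℝ) (h : Solves ρ S G a b u) :
    Solves ρ S G (r • a) (r • b) (r • u) := by
  obtain ⟨x, hx, hxu, h⟩ := h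
  refine ⟨r • x, G.smul_mem r hx, ?_, fun y hy v hv => ?_⟩
  · simp only [WithLp.smul_fst, hxu, evenPart, map_smul]; module
  · have := congrArg (r * ·) (h y hy v hv)
    have ho : oddPart ρ (r • u) = r • oddPart ρ u := by
      simp only [oddPart, map_smul]; module
    simp only [WithLp.smul_fst, WithLp.smul_snd, inner_smul_left, map_smul, ho,
      RCLike.conj_to_real] at this ⊢
    linarith

theorem Solves.sub {a a' : H} {b b' : B} {u u' : H} (h : Solves ρ S G a b u)
    (h' : Solves ρ S G a' b' u') : Solves ρ S G (a - a') (b - b') (u - u') := by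
  simpa [sub_eq_add_neg] using h.add (h'.smul (-1))

/-- Testing with the solution itself: the two derivative terms cancel. -/
theorem Solves.inner_self_le {a u : H} (h : Solves ρ S G a (0 : B) u) :
    inner ℝ (S u) u ≤ inner ℝ a u := by
  obtain ⟨x, hx, hxu, h⟩ := h
  have := h x hx u hxu
  rw [real_inner_comm x.snd.fst, real_inner_self_eq_norm_sq, inner_zero_left] at this
  nlinarith [sq_nonneg ‖x.snd.snd‖]

theorem Solves.unique {c : ℝ} (hc : 0 < c) (hS : ∀ u, c * ‖u‖ ^ 2 ≤ inner ℝ (S u) u)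
    {a u u' : H} {b : B} (h : Solves ρ S G a b u) (h' : Solves ρ S G a b u') : u = u' := by
  have h0 := h.sub h'
  rw [sub_self, sub_self] at h0
  have h1 := (hS (u - u')).trans h0.inner_self_le
  rw [inner_zero_left] at h1
  have h2 : ‖u - u'‖ ^ 2 = 0 := le_antisymm (by nlinarith) (sq_nonneg _)
  exact sub_eq_zero.1 (by simpa using h2)

/-- Solvability and uniqueness make the solution a linear function of the datum. -/
theorem exists_linearMap_solves {c : ℝ} (hc : 0 < c) (hS : ∀ u, c * ‖u‖ ^ 2 ≤ inner ℝ (S u) u)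
    (hex : ∀ a : H, ∃ u, Solves ρ S G a (0 : B) u) :
    ∃ L : H →ₗ[ℝ] H, ∀ a, Solves ρ S G a (0 : B) (L a) := by
  choose f hf using hex
  refine ⟨⟨⟨f, fun a a' => ?_⟩, fun r a => ?_⟩, hf⟩
  · refine (hf _).unique hc hS ?_
    simpa using (hf a).add (hf a')
  · refine (hf _).unique hc hS ?_
    simpa using (hf a).smul r

/-- A least squares problem with injective linear map on a finite-dimensional space has exactly
one solution. -/
theorem existsUnique_forall_norm_add_le {F : Type*} [AddCommGroup F] [Module ℝ F]
    [FiniteDimensional ℝ F] (L : F →ₗ[ℝ] H) (hL : Function.Injective L) (a : H) :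
    ∃! w, ∀ v, ‖a + L w‖ ^ 2 ≤ ‖a + L v‖ ^ 2 := by
  have : FiniteDimensional ℝ (LinearMap.range L) := inferInstance
  -- the minimizer maps to the orthogonal projection of `-a` onto the range
  obtain ⟨w, hw⟩ := ((LinearMap.range L).starProjection_apply_mem (-a))
  have horth : ∀ v, inner ℝ (a + L w) (L v) = 0 := fun v => by
    have := (LinearMap.range L).starProjection_inner_eq_zero (-a) (L v) ⟨v, rfl⟩
    rw [← hw, inner_sub_left, inner_neg_left] at this
    rw [inner_add_left]; linarith
  have hp : ∀ v, ‖a + L v‖ ^ 2 = ‖a + L w‖ ^ 2 + ‖L (v - w)‖ ^ 2 := fun v => by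
    have : a + L v = (a + L w) + L (v - w) := by rw [map_sub]; abel
    rw [this, norm_add_sq_real, horth]; ring
  refine ⟨w, fun v => by rw [hp v]; nlinarith [sq_nonneg ‖L (v - w)‖], fun v hv => ?_⟩
  have h0 := hv w
  rw [hp v] at h0
  have h1 : ‖L (v - w)‖ ^ 2 = 0 := le_antisymm (by linarith) (sq_nonneg _)
  have h2 : L (v - w) = 0 := by simpa using h1
  exact sub_eq_zero.1 (hL (by rw [h2, map_zero]))

end Abstract

variable {d : ℕ} {R : Set (Space d)}

/-! ### Finiteness of the surface measure -/

/-- Hyperplanes carry a finite `(d-1)`-dimensional measure on bounded sets. -/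
theorem euclideanHausdorffMeasure_hyperplane_inter_ball_lt_top {e : Space d} (he : e ≠ 0) (r : ℝ) :
    μHE[d - 1] (((ℝ ∙ e)ᗮ : Submodule ℝ (Space d)) ∩ closedBall (0 : Space d) r) < ⊤ := by
  have hfr : Module.finrank ℝ ((ℝ ∙ e)ᗮ : Submodule ℝ (Space d)) = d - 1 := by
    have h1 := (ℝ ∙ e).finrank_add_finrank_orthogonal
    rw [finrank_span_singleton he, finrank_euclideanSpace_fin] at h1
    omega
  have hset : (((ℝ ∙ e)ᗮ : Submodule ℝ (Space d)) ∩ closedBall (0 : Space d) r : Set (Space d))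
      = (Subtype.val : ((ℝ ∙ e)ᗮ : Submodule ℝ (Space d)) → Space d) '' closedBall 0 r := by
    ext y
    simp [and_comm]
  rw [hset, isometry_subtype_coe.euclideanHausdorffMeasure_image, ← hfr]
  exact (isCompact_closedBall _ _).measure_lt_top

theorem euclideanHausdorffMeasure_image_lt_top {f : Space d → Space d} {K : ℝ≥0}
    (hf : LipschitzWith K f) {k : ℕ} {s : Set (Space d)} (hs : μHE[k] s < ⊤) :
    μHE[k] (f '' s) < ⊤ := by
  rw [Measure.euclideanHausdorffMeasure_def] at hs ⊢
  have h := hf.hausdorffMeasure_image_le (d := (k : ℝ)) (by positivity) s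
  have hne := Measure.addHaarScalarFactor_volume_hausdorffMeasure_ne_zero k
  rw [Measure.smul_apply] at hs ⊢
  rw [ENNReal.smul_def, smul_eq_mul] at hs ⊢
  have hs' : μH[(k : ℝ)] s < ⊤ := by
    by_contra hcon
    rw [not_lt, top_le_iff] at hcon
    rw [hcon, ENNReal.mul_top (by exact_mod_cast hne)] at hs
    exact lt_irrefl _ hs
  refine ENNReal.mul_lt_top ENNReal.coe_lt_top (h.trans_lt (ENNReal.mul_lt_top ?_ hs'))
  exact ENNReal.rpow_lt_top_of_nonneg (by positivity) ENNReal.coe_ne_top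

/-- The boundary is compact, and near each of its points it is contained in a Lipschitz graph over a
hyperplane. -/
theorem isFiniteMeasure_surfaceMeasure (hRo : IsOpen R) (hRb : Bornology.IsBounded R)
    (hRL : HasLipschitzBoundary R) : IsFiniteMeasure (surfaceMeasure R) := by
  have hc : IsCompact (frontier R) :=
    Metric.isCompact_of_isClosed_isBounded isClosed_frontier
      (hRb.closure.subset frontier_subset_closure)
  have key : μHE[d - 1] (frontier R) < ⊤ := by
    refine hc.measure_lt_top_of_nhdsWithin fun x hx => ?_
    obtain ⟨e, K, φ, ρ, he, hφ, hρ, hy⟩ := hRL x hx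
    have he0 : e ≠ 0 := by rintro rfl; simp at he
    have hproj : ∀ y : Space d, y - inner ℝ e y • e ∈ ((ℝ ∙ e)ᗮ : Submodule ℝ (Space d)) := by
      intro y
      rw [Submodule.mem_orthogonal_singleton_iff_inner_right, inner_sub_right, inner_smul_right,
        real_inner_self_eq_norm_sq, he]
      ring
    have hcont : Continuous fun y : Space d => y - inner ℝ e y • e := by fun_prop
    have hlip : LipschitzWith (1 + K) fun z : Space d => z + φ z • e := by
      refine LipschitzWith.id.add (LipschitzWith.of_dist_le_mul fun z z' => ?_)
      rw [dist_eq_norm, ← sub_smul, norm_smul, he, mul_one, ← dist_eq_norm]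
      exact hφ.dist_le_mul z z'
    refine ⟨frontier R ∩ ball x ρ, inter_mem_nhdsWithin _ (ball_mem_nhds x hρ), ?_⟩
    refine (measure_mono ?_).trans_lt (euclideanHausdorffMeasure_image_lt_top hlip
      (euclideanHausdorffMeasure_hyperplane_inter_ball_lt_top he0 (2 * (‖x‖ + ρ))))
    rintro y ⟨hyf, hyb⟩
    have hyR : y ∉ R := fun h => hRo.inter_frontier_eq.subset ⟨h, hyf⟩
    have hge : φ (y - inner ℝ e y • e) ≤ inner ℝ e y := by
      by_contra! hlt
      exact hyR ((hy y hyb).2 hlt)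
    have hle : inner ℝ e y ≤ φ (y - inner ℝ e y • e) := by
      by_contra! hgt
      -- above the graph lies an open set disjoint from `R`
      have hU : ∀ᶠ z in 𝓝 y, z ∉ R := by
        have h1 : ∀ᶠ z in 𝓝 y, φ (z - inner ℝ e z • e) < inner ℝ e z :=
          (hφ.continuous.comp hcont).continuousAt.eventually_lt (by fun_prop) hgt
        filter_upwards [h1, isOpen_ball.mem_nhds hyb] with z hz hzb hzR
        exact absurd ((hy z hzb).1 hzR) hz.le.not_gt
      obtain ⟨z, hz, hzR⟩ := (hU.and_frequently
        (mem_closure_iff_frequently.1 (frontier_subset_closure hyf))).exists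
      exact hz hzR
    refine ⟨y - inner ℝ e y • e, ⟨hproj y, ?_⟩, ?_⟩
    · rw [mem_closedBall_zero_iff]
      have h1 : ‖y‖ ≤ ‖x‖ + ρ := by
        have := norm_le_norm_add_norm_sub' y x
        rw [mem_ball, dist_eq_norm] at hyb
        linarith
      have h2 : ‖inner ℝ e y • e‖ ≤ ‖y‖ := by
        rw [norm_smul, he, mul_one]
        exact (norm_inner_le_norm _ _).trans (by rw [he, one_mul])
      linarith [norm_sub_le y (inner ℝ e y • e)]
    · simp only [le_antisymm hge hle, sub_add_cancel]
  exact ⟨by simpa [surfaceMeasure] using key⟩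

/-! ### The normal component of directions -/

theorem measurable_normal (R : Set (Space d)) : Measurable (normal R) := by
  unfold normal
  split_ifs with h
  · exact h.choose_spec.1
  · exact measurable_zero

theorem norm_normal_le (R : Set (Space d)) : ∀ᵐ x ∂(surfaceMeasure R), ‖normal R x‖ ≤ 1 := by
  unfold normal
  split_ifs with h
  · filter_upwards [h.choose_spec.2] with x hx using hx.1.le
  · simp

theorem measurable_sn (R : Set (Space d)) : Measurable (sn R) :=
  (measurable_subtype_coe.comp measurable_snd).inner ((measurable_normal R).comp measurable_fst)

theorem abs_sn_le_one (R : Set (Space d)) [SFinite (surfaceMeasure R)] :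
    ∀ᵐ p ∂(bdryMeasure R), |sn R p| ≤ 1 := by
  have := (Measure.quasiMeasurePreserving_fst (μ := surfaceMeasure R)
    (ν := dirMeasure d)).ae (norm_normal_le R)
  filter_upwards [this] with p hp
  refine (abs_real_inner_le_norm _ _).trans ?_
  rw [norm_eq_of_mem_sphere p.2, one_mul]
  exact hp

/-! ### Reflection of directions -/

open scoped Pointwise in
theorem measurePreserving_neg_dir : MeasurePreserving (Neg.neg : Dir d → Dir d)
    (dirMeasure d) (dirMeasure d) := by
  refine ⟨continuous_neg.measurable, ?_⟩
  ext s hs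
  rw [Measure.map_apply continuous_neg.measurable hs,
    Measure.toSphere_apply' _ (continuous_neg.measurable hs), Measure.toSphere_apply' _ hs]
  congr 1
  have : Ioo (0 : ℝ) 1 • ((↑) '' ((Neg.neg : Dir d → Dir d) ⁻¹' s) : Set (Space d))
      = Neg.neg ⁻¹' (Ioo (0 : ℝ) 1 • ((↑) '' s : Set (Space d))) := by
    ext y
    simp only [mem_smul, mem_image, mem_preimage]
    constructor
    · rintro ⟨t, ht, _, ⟨z, hz, rfl⟩, rfl⟩
      exact ⟨t, ht, _, ⟨-z, hz, rfl⟩, by simp⟩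
    · rintro ⟨t, ht, _, ⟨z, hz, rfl⟩, hy⟩
      exact ⟨t, ht, _, ⟨-z, by simpa using hz, rfl⟩, by rw [← neg_neg y, ← hy]; simp⟩
  rw [this, Measure.measure_preimage_neg]

/-- The reflection `(r, s) ↦ (r, -s)`. -/
noncomputable def reflect (p : Space d × Dir d) : Space d × Dir d := (p.1, -p.2)

theorem measurePreserving_reflect (R : Set (Space d)) :
    MeasurePreserving reflect (phaseMeasure R) (phaseMeasure R) :=
  (MeasurePreserving.id _).prod measurePreserving_neg_dir

/-! ### Inner products in `L²` as integrals -/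

theorem inner_eq_integral_mul {α : Type*} [MeasurableSpace α] {μ : Measure α} (f g : Lp ℝ 2 μ) :
    inner ℝ f g = ∫ x, f x * g x ∂μ := by
  rw [L2.inner_def]
  simp only [Real.inner_apply]

theorem inner_toLp_eq_integral {α : Type*} [MeasurableSpace α] {μ : Measure α} {φ : α → ℝ}
    (hφ : MemLp φ 2 μ) (g : Lp ℝ 2 μ) : inner ℝ hφ.toLp g = ∫ x, φ x * g x ∂μ := by
  rw [inner_eq_integral_mul]
  refine integral_congr_ae ?_
  filter_upwards [hφ.coeFn_toLp] with x hx
  rw [hx]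

/-! ### The measures on the phase space and on its boundary -/

theorem isFiniteMeasure_phaseMeasure (hRb : Bornology.IsBounded R) :
    IsFiniteMeasure (phaseMeasure R) := by
  have : IsFiniteMeasure ((volume : Measure (Space d)).restrict R) :=
    ⟨by simpa using hRb.measure_lt_top⟩
  unfold phaseMeasure
  infer_instance

theorem ae_phaseMeasure_of_ae {P : Space d → Prop} (h : ∀ᵐ r ∂(volume.restrict R), P r) :
    ∀ᵐ p ∂(phaseMeasure R), P p.1 :=
  Measure.quasiMeasurePreserving_fst.ae h

theorem ae_phaseMeasure_mem (hRo : IsOpen R) : ∀ᵐ p ∂(phaseMeasure R), p.1 ∈ R :=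
  ae_phaseMeasure_of_ae (ae_restrict_mem hRo.measurableSet)

theorem ae_bdryMeasure_mem (R : Set (Space d)) [SFinite (surfaceMeasure R)] :
    ∀ᵐ p ∂(bdryMeasure R), p.1 ∈ frontier R :=
  Measure.quasiMeasurePreserving_fst.ae (ae_restrict_mem isClosed_frontier.measurableSet)

theorem wBdryMeasure_absolutelyContinuous (R : Set (Space d)) : wBdryMeasure R ≪ bdryMeasure R :=
  withDensity_absolutelyContinuous _ _

theorem measurable_ofReal_abs_sn (R : Set (Space d)) :
    Measurable fun p => ENNReal.ofReal |sn R p| := by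
  have := measurable_sn R
  fun_prop

theorem isFiniteMeasure_wBdryMeasure (R : Set (Space d)) [IsFiniteMeasure (surfaceMeasure R)] :
    IsFiniteMeasure (wBdryMeasure R) := by
  have : IsFiniteMeasure (bdryMeasure R) := by unfold bdryMeasure; infer_instance
  refine isFiniteMeasure_withDensity ?_
  refine ((lintegral_mono_ae (g := fun _ => 1) ?_).trans_lt ?_).ne
  · filter_upwards [abs_sn_le_one R] with p hp
    simpa using hp
  · simp

theorem integral_wBdryMeasure (R : Set (Space d)) (F : Space d × Dir d → ℝ) :
    ∫ p, F p ∂(wBdryMeasure R) = ∫ p, |sn R p| * F p ∂(bdryMeasure R) := by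
  rw [wBdryMeasure, integral_withDensity_eq_integral_toReal_smul (measurable_ofReal_abs_sn R)
    (ae_of_all _ fun _ => ENNReal.ofReal_lt_top)]
  simp [ENNReal.toReal_ofReal (abs_nonneg _)]

/-- The sign of `s ⋅ n`, written as a quotient; where `s ⋅ n = 0` both sides vanish. -/
theorem sn_div_abs_mul (p : Space d × Dir d) (x : ℝ) :
    |sn R p| * (sn R p / |sn R p| * x) = sn R p * x := by
  by_cases h : sn R p = 0
  · simp [h]
  · field_simp

/-! ### Test functions -/

/-- The embedding of `ℝ^d × S^{d-1}` into `ℝ^d × ℝ^d`, on which test functions live. -/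
noncomputable def incl (p : Space d × Dir d) : Space d × Space d := (p.1, p.2)

theorem continuous_incl : Continuous (incl : Space d × Dir d → _) := by unfold incl; fun_prop

theorem measurableEmbedding_incl : MeasurableEmbedding (incl : Space d × Dir d → _) :=
  MeasurableEmbedding.id.prodMap (MeasurableEmbedding.subtype_coe isClosed_sphere.measurableSet)

/-- A function on phase space is determined almost everywhere on an open set by its integrals
against test functions. -/
theorem ae_eq_zero_of_integral_mul_test_eq_zero {μ : Measure (Space d × Dir d)}
    {h : Space d × Dir d → ℝ} (hh : Integrable h μ) {U : Set (Space d × Space d)} (hU : IsOpen U)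
    (h0 : ∀ w : Space d × Space d → ℝ, ContDiff ℝ ∞ w → HasCompactSupport w → tsupport w ⊆ U →
      ∫ p, h p * w (incl p) ∂μ = 0) :
    ∀ᵐ p ∂μ, incl p ∈ U → h p = 0 := by
  have hemb := measurableEmbedding_incl (d := d)
  have hext : ∀ p, Function.extend incl h 0 (incl p) = h p := fun p =>
    hemb.injective.extend_apply h 0 p
  have hint : Integrable (Function.extend incl h 0) (μ.map incl) := by
    rw [hemb.integrable_map_iff]
    exact hh.congr (ae_of_all _ fun p => (hext p).symm)
  have key := hU.ae_eq_zero_of_integral_contDiff_smul_eq_zero (μ := μ.map incl)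
    (f := Function.extend incl h 0) (hint.locallyIntegrable.locallyIntegrableOn U)
    (fun w hw hc hs => by
      rw [hemb.integral_map]
      simpa only [hext, smul_eq_mul, mul_comm] using h0 w hw hc hs)
  have := (hemb.ae_map_iff).1 key
  simpa only [hext] using this

/-- The factor `σ` serves for the sign of `s ⋅ n` in the boundary term. -/
theorem memLp_two_comp_incl {μ : Measure (Space d × Dir d)} [IsFiniteMeasure μ]
    {C : Set (Space d)} (hC : IsCompact C) (hμ : ∀ᵐ p ∂μ, p.1 ∈ C) {σ : Space d × Dir d → ℝ}
    (hσ : Measurable σ) (hσ1 : ∀ p, |σ p| ≤ 1) {w : Space d × Space d → ℝ} (hw : Continuous w) :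
    MemLp (fun p => σ p * w (incl p)) 2 μ := by
  obtain ⟨M, hM⟩ := (hC.prod (isCompact_sphere (0 : Space d) 1)).exists_bound_of_continuousOn
    hw.continuousOn
  refine MemLp.of_bound (hσ.mul (hw.comp continuous_incl).measurable).aestronglyMeasurable M ?_
  filter_upwards [hμ] with p hp
  rw [norm_mul, Real.norm_eq_abs]
  exact (mul_le_of_le_one_left (norm_nonneg _) (hσ1 p)).trans (hM (incl p) ⟨hp, p.2.2⟩)

/-- For a fixed test function the three terms of the integration by parts formula are continuous
linear functionals of the derivative, the function and the trace. -/
theorem exists_inner_eq_integral_test (hRo : IsOpen R) (hRb : Bornology.IsBounded R)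
    [IsFiniteMeasure (surfaceMeasure R)] {w : Space d × Space d → ℝ} (hw : ContDiff ℝ ∞ w) :
    ∃ (a b : V0 R) (c : L2Bdry R),
      (∀ g : V0 R, ∫ p, g p * w (p.1, (p.2 : Space d)) ∂(phaseMeasure R) = inner ℝ a g) ∧
      (∀ v : V0 R, ∫ p, v p * fderiv ℝ w (p.1, (p.2 : Space d)) ((p.2 : Space d), 0)
        ∂(phaseMeasure R) = inner ℝ b v) ∧
      ∀ f : L2Bdry R, ∫ p, sn R p * f p * w (p.1, (p.2 : Space d)) ∂(bdryMeasure R)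
        = inner ℝ c f := by
  have := isFiniteMeasure_phaseMeasure hRb
  have := isFiniteMeasure_wBdryMeasure R
  have hC : IsCompact (closure R) := hRb.isCompact_closure
  have hD : ∀ᵐ p ∂(phaseMeasure R), p.1 ∈ closure R :=
    (ae_phaseMeasure_mem hRo).mono fun p hp => subset_closure hp
  have hB : ∀ᵐ p ∂(wBdryMeasure R), p.1 ∈ closure R :=
    (wBdryMeasure_absolutelyContinuous R).ae_le
      ((ae_bdryMeasure_mem R).mono fun p hp => frontier_subset_closure hp)
  have hdw : Continuous fun z : Space d × Space d => fderiv ℝ w z (z.2, 0) :=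
    (hw.continuous_fderiv (by simp)).clm_apply (by fun_prop)
  have ha := memLp_two_comp_incl hC hD (σ := fun _ => 1) measurable_const (by simp) hw.continuous
  have hb := memLp_two_comp_incl hC hD (σ := fun _ => 1) measurable_const (by simp) hdw
  have hc := memLp_two_comp_incl hC hB (σ := fun p => sn R p / |sn R p|)
    ((measurable_sn R).div (measurable_sn R).abs)
    (fun p => by rw [abs_div, abs_abs]; exact div_self_le_one _) hw.continuous
  refine ⟨ha.toLp, hb.toLp, hc.toLp, fun g => ?_, fun v => ?_, fun f => ?_⟩
  · rw [inner_toLp_eq_integral]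
    exact integral_congr_ae (ae_of_all _ fun p => by simp only [incl]; ring)
  · rw [inner_toLp_eq_integral]
    exact integral_congr_ae (ae_of_all _ fun p => by simp only [incl]; ring)
  · have h1 : inner ℝ hc.toLp f
        = ∫ p, sn R p / |sn R p| * (f p * w (incl p)) ∂(wBdryMeasure R) := by
      rw [inner_toLp_eq_integral]
      exact integral_congr_ae (ae_of_all _ fun p => by ring)
    rw [h1, integral_wBdryMeasure]
    simp only [sn_div_abs_mul, incl, mul_assoc]

/-! ### Uniqueness of the directional derivative and of the trace -/

theorem IsDerivTrace.congr {v v' : Space d × Dir d → ℝ} {g : V0 R} {f : L2Bdry R}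
    (h : IsDerivTrace R v g f) (hv : v =ᵐ[phaseMeasure R] v') : IsDerivTrace R v' g f := by
  intro w hw
  rw [← h w hw]
  congr 1
  refine integral_congr_ae ?_
  filter_upwards [hv] with p hp
  rw [hp]

theorem tsupport_subset_eq_zero {w : Space d × Space d → ℝ} (hw : tsupport w ⊆ R ×ˢ univ)
    {x : Space d} (hx : x ∉ R) (s : Space d) : w (x, s) = 0 :=
  image_eq_zero_of_notMem_tsupport fun h => hx (hw h).1

/-- For test functions supported inside `R` the boundary term vanishes. -/
theorem IsDerivTrace.interior (hRo : IsOpen R) [SFinite (surfaceMeasure R)]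
    {v : Space d × Dir d → ℝ} {g : V0 R} {f : L2Bdry R} (h : IsDerivTrace R v g f)
    {w : Space d × Space d → ℝ} (hw : ContDiff ℝ ∞ w) (hws : tsupport w ⊆ R ×ˢ univ) :
    ∫ p, g p * w (p.1, (p.2 : Space d)) ∂(phaseMeasure R)
      = -∫ p, v p * fderiv ℝ w (p.1, (p.2 : Space d)) ((p.2 : Space d), 0) ∂(phaseMeasure R) := by
  rw [eq_neg_iff_add_eq_zero, h w hw]
  refine integral_eq_zero_of_ae ?_
  filter_upwards [ae_bdryMeasure_mem R] with p hp
  have : p.1 ∉ R := fun h => hRo.inter_frontier_eq.subset ⟨h, hp⟩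
  simp [tsupport_subset_eq_zero hws this]

/-- Test functions supported inside `R` separate the points of `L²(D)`. -/
theorem eq_zero_of_integral_mul_interior_test (hRo : IsOpen R) (hRb : Bornology.IsBounded R)
    {g : V0 R} (h : ∀ w : Space d × Space d → ℝ, ContDiff ℝ ∞ w → tsupport w ⊆ R ×ˢ univ →
      ∫ p, g p * w (p.1, (p.2 : Space d)) ∂(phaseMeasure R) = 0) : g = 0 := by
  have := isFiniteMeasure_phaseMeasure hRb
  have key := ae_eq_zero_of_integral_mul_test_eq_zero ((Lp.memLp g).integrable one_le_two)
    (hRo.prod isOpen_univ) (fun w hw _ hs => h w hw hs)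
  rw [Lp.eq_zero_iff_ae_eq_zero]
  filter_upwards [key, ae_phaseMeasure_mem hRo] with p hp hpR
  exact hp ⟨hpR, mem_univ _⟩

/-- Interior test functions determine the derivative; with the derivative known, all test functions
together determine the trace. -/
theorem IsDerivTrace.unique (hRo : IsOpen R) (hRb : Bornology.IsBounded R)
    [IsFiniteMeasure (surfaceMeasure R)]
    {v : Space d × Dir d → ℝ} {g g' : V0 R} {f f' : L2Bdry R} (h : IsDerivTrace R v g f)
    (h' : IsDerivTrace R v g' f') : g = g' ∧ f = f' := by
  have hg : g = g' := by
    rw [← sub_eq_zero]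
    refine eq_zero_of_integral_mul_interior_test hRo hRb fun w hw hs => ?_
    obtain ⟨a, b, c, ha, -, -⟩ := exists_inner_eq_integral_test hRo hRb hw
    rw [ha, inner_sub_right, ← ha, ← ha, h.interior hRo hw hs, h'.interior hRo hw hs, sub_self]
  refine ⟨hg, ?_⟩
  subst hg
  have := isFiniteMeasure_wBdryMeasure R
  rw [← sub_eq_zero, Lp.eq_zero_iff_ae_eq_zero]
  have hmem : MemLp (fun p => sn R p / |sn R p| * (f - f') p) 2 (wBdryMeasure R) := by
    refine (Lp.memLp (f - f')).of_le (((measurable_sn R).div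
      (measurable_sn R).abs).aestronglyMeasurable.mul (Lp.aestronglyMeasurable _))
      (ae_of_all _ fun p => ?_)
    rw [norm_mul]
    refine mul_le_of_le_one_left (norm_nonneg _) ?_
    rw [Real.norm_eq_abs, abs_div, abs_abs]
    exact div_self_le_one _
  have key := ae_eq_zero_of_integral_mul_test_eq_zero (hmem.integrable one_le_two)
    isOpen_univ (fun w hw _ _ => by
      obtain ⟨a, b, c, -, -, hc⟩ := exists_inner_eq_integral_test hRo hRb hw
      have h1 : ∫ p, sn R p * (f - f') p * w (p.1, (p.2 : Space d)) ∂(bdryMeasure R) = 0 := by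
        rw [hc, inner_sub_right, ← hc, ← hc, ← h w hw, ← h' w hw, sub_self]
      simp only [mul_assoc]
      rw [integral_wBdryMeasure]
      simpa only [sn_div_abs_mul, mul_assoc, incl] using h1)
  have hsn : ∀ᵐ p ∂(wBdryMeasure R), sn R p ≠ 0 := by
    rw [wBdryMeasure, ae_withDensity_iff (measurable_ofReal_abs_sn R)]
    refine ae_of_all _ fun p hp h0 => hp ?_
    simp [h0]
  filter_upwards [key, hsn] with p hp hp0
  have := hp (mem_univ _)
  simpa [hp0] using this

/-- The chosen derivative and trace are those of any integration by parts formula for `v`. -/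
theorem sGrad_eq (hRo : IsOpen R) (hRb : Bornology.IsBounded R) [IsFiniteMeasure (surfaceMeasure R)]
    {v : Space d × Dir d → ℝ} (hv : MemLp v 2 (phaseMeasure R)) {g : V0 R} {f : L2Bdry R}
    (h : IsDerivTrace R v g f) : sGrad R v = g ∧ trace R v = f := by
  have hm : MemV1 R v := ⟨hv, g, f, h⟩
  rw [sGrad, trace, dif_pos hm, dif_pos hm]
  exact hm.2.choose_spec.choose_spec.unique hRo hRb h

/-! ### Parity in the direction variable -/

/-- The reflection of directions as an operator on `L²(D)`. -/
noncomputable def reflOp (R : Set (Space d)) : V0 R →L[ℝ] V0 R :=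
  (Lp.compMeasurePreservingₗᵢ ℝ reflect (measurePreserving_reflect R)).toContinuousLinearMap

theorem coeFn_reflOp (u : V0 R) : reflOp R u =ᵐ[phaseMeasure R] u ∘ reflect :=
  Lp.coeFn_compMeasurePreserving u (measurePreserving_reflect R)

theorem reflect_reflect (p : Space d × Dir d) : reflect (reflect p) = p := by simp [reflect]

theorem measurableEmbedding_reflect : MeasurableEmbedding (reflect : Space d × Dir d → _) :=
  (MeasurableEquiv.mk (Equiv.mk reflect reflect reflect_reflect reflect_reflect)
    (measurePreserving_reflect univ).measurable
    (measurePreserving_reflect univ).measurable).measurableEmbedding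

theorem integral_comp_reflect (R : Set (Space d)) (F : Space d × Dir d → ℝ) :
    ∫ p, F (reflect p) ∂(phaseMeasure R) = ∫ p, F p ∂(phaseMeasure R) :=
  (measurePreserving_reflect R).integral_comp measurableEmbedding_reflect F

theorem reflOp_reflOp (u : V0 R) : reflOp R (reflOp R u) = u := by
  refine Lp.ext ?_
  filter_upwards [coeFn_reflOp (reflOp R u),
    (measurePreserving_reflect R).quasiMeasurePreserving.ae_eq_comp (coeFn_reflOp u)] with p h1 h2
  rw [h1, h2, Function.comp_apply, Function.comp_apply, reflect_reflect]

theorem inner_reflOp_left (u v : V0 R) : inner ℝ (reflOp R u) v = inner ℝ u (reflOp R v) := by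
  conv_lhs => rw [← reflOp_reflOp v]
  exact LinearIsometry.inner_map_map (𝕜 := ℝ) (E := V0 R) (E' := V0 R)
    (Lp.compMeasurePreservingₗᵢ ℝ reflect (measurePreserving_reflect R)) _ _

theorem coeFn_evenPart (u : V0 R) : (evenPart (reflOp R) u : V0 R) =ᵐ[phaseMeasure R] even u := by
  filter_upwards [Lp.coeFn_smul (2⁻¹ : ℝ) (u + reflOp R u), Lp.coeFn_add u (reflOp R u),
    coeFn_reflOp u] with p h1 h2 h3
  rw [evenPart, h1, Pi.smul_apply, h2, Pi.add_apply, h3, even, smul_eq_mul]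
  simp only [Function.comp_apply, reflect]
  ring

theorem coeFn_oddPart (u : V0 R) : (oddPart (reflOp R) u : V0 R) =ᵐ[phaseMeasure R] odd u := by
  filter_upwards [Lp.coeFn_smul (2⁻¹ : ℝ) (u - reflOp R u), Lp.coeFn_sub u (reflOp R u),
    coeFn_reflOp u] with p h1 h2 h3
  rw [oddPart, h1, Pi.smul_apply, h2, Pi.sub_apply, h3, odd, smul_eq_mul]
  simp only [Function.comp_apply, reflect]
  ring

theorem memLp_even (u : V0 R) : MemLp (even u) 2 (phaseMeasure R) :=
  (Lp.memLp (evenPart (reflOp R) u)).ae_eq (coeFn_evenPart u)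

/-- The directional derivative of an even function is odd: reflecting `s` in a test function
changes the sign of `s ⋅ ∇`. -/
theorem IsDerivTrace.reflOp_eq_neg (hRo : IsOpen R) (hRb : Bornology.IsBounded R)
    [IsFiniteMeasure (surfaceMeasure R)] {v g : V0 R} {f : L2Bdry R} (hv : reflOp R v = v)
    (h : IsDerivTrace R v g f) : reflOp R g = -g := by
  rw [← add_eq_zero_iff_eq_neg]
  refine eq_zero_of_integral_mul_interior_test hRo hRb fun w hw hs => ?_
  -- the test function with reflected direction
  let τ : Space d × Space d →L[ℝ] Space d × Space d :=
    (ContinuousLinearMap.fst ℝ _ _).prod (-ContinuousLinearMap.snd ℝ _ _)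
  have hτ : ∀ z, τ z = (z.1, -z.2) := fun z => rfl
  have hτc : Continuous τ := τ.continuous
  have hw' : ContDiff ℝ ∞ (w ∘ τ) := hw.comp τ.contDiff
  have hs' : tsupport (w ∘ τ) ⊆ R ×ˢ univ := fun z hz =>
    ⟨(hs (tsupport_comp_subset_preimage w hτc hz)).1, mem_univ _⟩
  have hd : ∀ x s : Space d, fderiv ℝ (w ∘ τ) (x, s) (s, 0) = fderiv ℝ w (x, -s) (s, 0) := by
    intro x s
    rw [fderiv_comp _ (hw.differentiable (by simp) _) τ.differentiableAt, τ.fderiv]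
    simp [hτ]
  have e3 : ∫ p, (reflOp R g) p * w (p.1, (p.2 : Space d)) ∂(phaseMeasure R)
      = ∫ p, g p * (w ∘ τ) (p.1, (p.2 : Space d)) ∂(phaseMeasure R) := by
    symm
    rw [← integral_comp_reflect]
    refine integral_congr_ae ?_
    filter_upwards [coeFn_reflOp g] with p hp
    simp [hp, reflect, hτ]
  have e4 : ∫ p, v p * fderiv ℝ (w ∘ τ) (p.1, (p.2 : Space d)) ((p.2 : Space d), 0)
        ∂(phaseMeasure R)
      = -∫ p, v p * fderiv ℝ w (p.1, (p.2 : Space d)) ((p.2 : Space d), 0)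
        ∂(phaseMeasure R) := by
    rw [← integral_comp_reflect, ← integral_neg]
    refine integral_congr_ae ?_
    filter_upwards [coeFn_reflOp v] with p hp
    rw [hv, Function.comp_apply] at hp
    have hneg : ((-(p.2 : Space d), 0) : Space d × Space d) = -((p.2 : Space d), 0) := by simp
    rw [← hp, hd]
    simp only [reflect, InvolutiveNeg.neg_neg, coe_neg_sphere]
    rw [hneg, map_neg, mul_neg]
  obtain ⟨a, b, c, ha, -, -⟩ := exists_inner_eq_integral_test hRo hRb hw
  rw [ha, inner_add_right, ← ha, ← ha, e3, h.interior hRo hw' hs', e4, h.interior hRo hw hs]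
  ring

/-! ### The graph of directional derivative and trace on even functions -/

theorem isDerivTrace_iff_of_inner {w : Space d × Space d → ℝ} {a b : V0 R} {c : L2Bdry R}
    (ha : ∀ g : V0 R, ∫ p, g p * w (p.1, (p.2 : Space d)) ∂(phaseMeasure R) = inner ℝ a g)
    (hb : ∀ v : V0 R, ∫ p, v p * fderiv ℝ w (p.1, (p.2 : Space d)) ((p.2 : Space d), 0)
        ∂(phaseMeasure R) = inner ℝ b v)
    (hc : ∀ f : L2Bdry R, ∫ p, sn R p * f p * w (p.1, (p.2 : Space d)) ∂(bdryMeasure R)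
        = inner ℝ c f) (v g : V0 R) (f : L2Bdry R) :
    ((∫ p, g p * w (p.1, (p.2 : Space d)) ∂(phaseMeasure R))
      + (∫ p, v p * fderiv ℝ w (p.1, (p.2 : Space d)) ((p.2 : Space d), 0) ∂(phaseMeasure R))
    = ∫ p, sn R p * f p * w (p.1, (p.2 : Space d)) ∂(bdryMeasure R)) ↔
    inner ℝ a g + inner ℝ b v - inner ℝ c f = 0 := by
  rw [ha, hb, hc, sub_eq_zero]

/-- The triples `(v, s ⋅ ∇v, trace v)` with `v` even. By uniqueness of derivative and trace this is
the graph of a linear map on `V₁⁺`. -/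
noncomputable def evenGraph (hRo : IsOpen R) (hRb : Bornology.IsBounded R)
    [IsFiniteMeasure (surfaceMeasure R)] : Submodule ℝ (Triple (V0 R) (L2Bdry R)) where
  carrier := {x | reflOp R x.fst = x.fst ∧ IsDerivTrace R x.fst x.snd.fst x.snd.snd}
  add_mem' := by
    rintro x y ⟨hx, hx'⟩ ⟨hy, hy'⟩
    refine ⟨by rw [WithLp.add_fst, map_add, hx, hy], fun w hw => ?_⟩
    obtain ⟨a, b, c, ha, hb, hc⟩ := exists_inner_eq_integral_test hRo hRb hw
    have h1 := (isDerivTrace_iff_of_inner ha hb hc _ _ _).1 (hx' w hw)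
    have h2 := (isDerivTrace_iff_of_inner ha hb hc _ _ _).1 (hy' w hw)
    rw [isDerivTrace_iff_of_inner ha hb hc]
    simp only [WithLp.add_fst, WithLp.add_snd, inner_add_right]
    linarith
  zero_mem' := by
    refine ⟨by simp, fun w hw => ?_⟩
    obtain ⟨a, b, c, ha, hb, hc⟩ := exists_inner_eq_integral_test hRo hRb hw
    rw [isDerivTrace_iff_of_inner ha hb hc]
    simp
  smul_mem' := by
    rintro r x ⟨hx, hx'⟩
    refine ⟨by rw [WithLp.smul_fst, map_smul, hx], fun w hw => ?_⟩
    obtain ⟨a, b, c, ha, hb, hc⟩ := exists_inner_eq_integral_test hRo hRb hw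
    have h1 := (isDerivTrace_iff_of_inner ha hb hc _ _ _).1 (hx' w hw)
    rw [isDerivTrace_iff_of_inner ha hb hc]
    simp only [WithLp.smul_fst, WithLp.smul_snd, inner_smul_right]
    linear_combination r * h1

theorem isClosed_evenGraph (hRo : IsOpen R) (hRb : Bornology.IsBounded R)
    [IsFiniteMeasure (surfaceMeasure R)] :
    IsClosed (evenGraph hRo hRb : Set (Triple (V0 R) (L2Bdry R))) := by
  have h1 : Continuous fun x : Triple (V0 R) (L2Bdry R) => x.fst :=
    (WithLp.fstL 2 ℝ _ _).continuous
  have h2 : Continuous fun x : Triple (V0 R) (L2Bdry R) => x.snd :=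
    (WithLp.sndL 2 ℝ _ _).continuous
  have h3 : Continuous fun x : WithLp 2 (V0 R × L2Bdry R) => x.fst :=
    (WithLp.fstL 2 ℝ _ _).continuous
  have h4 : Continuous fun x : WithLp 2 (V0 R × L2Bdry R) => x.snd :=
    (WithLp.sndL 2 ℝ _ _).continuous
  suffices hD : IsClosed {x : Triple (V0 R) (L2Bdry R) |
      IsDerivTrace R x.fst x.snd.fst x.snd.snd} from
    (isClosed_eq ((reflOp R).continuous.comp h1) h1).inter hD
  simp only [IsDerivTrace, Set.ofPred_forall]
  refine isClosed_iInter fun w => isClosed_iInter fun hw => ?_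
  obtain ⟨a, b, c, ha, hb, hc⟩ := exists_inner_eq_integral_test hRo hRb hw
  simp only [isDerivTrace_iff_of_inner ha hb hc]
  exact isClosed_eq (((continuous_const.inner (h3.comp h2)).add (continuous_const.inner h1)).sub
    (continuous_const.inner (h4.comp h2))) continuous_const

theorem mem_evenGraph_parity (hRo : IsOpen R) (hRb : Bornology.IsBounded R)
    [IsFiniteMeasure (surfaceMeasure R)] {x : Triple (V0 R) (L2Bdry R)}
    (hx : x ∈ evenGraph hRo hRb) :
    reflOp R x.fst = x.fst ∧ reflOp R x.snd.fst = -x.snd.fst :=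
  ⟨hx.1, hx.2.reflOp_eq_neg hRo hRb hx.1⟩

theorem mem_W_iff (hRo : IsOpen R) (hRb : Bornology.IsBounded R)
    [IsFiniteMeasure (surfaceMeasure R)] (u : V0 R) :
    u ∈ W R ↔ ∃ x ∈ evenGraph hRo hRb, x.fst = evenPart (reflOp R) u := by
  constructor
  · rintro ⟨-, g, f, h⟩
    refine ⟨WithLp.toLp 2 (evenPart (reflOp R) u, WithLp.toLp 2 (g, f)), ⟨?_, ?_⟩, rfl⟩
    · change reflOp R (evenPart (reflOp R) u) = evenPart (reflOp R) u
      simp only [evenPart, map_smul, map_add, reflOp_reflOp]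
      rw [add_comm]
    · exact h.congr (coeFn_evenPart u).symm
  · rintro ⟨x, hx, hxu⟩
    exact ⟨memLp_even u, x.snd.fst, x.snd.snd, hx.2.congr (hxu ▸ coeFn_evenPart u)⟩

theorem sGrad_trace_even_eq (hRo : IsOpen R) (hRb : Bornology.IsBounded R)
    [IsFiniteMeasure (surfaceMeasure R)] {u : V0 R} {x : Triple (V0 R) (L2Bdry R)}
    (hx : x ∈ evenGraph hRo hRb) (hxu : x.fst = evenPart (reflOp R) u) :
    sGrad R (even u) = x.snd.fst ∧ trace R (even u) = x.snd.snd :=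
  sGrad_eq hRo hRb (memLp_even u) (hx.2.congr (hxu ▸ coeFn_evenPart u))

/-! ### Multiplication operators -/

theorem memLp_top_comp_fst {φ : Space d → ℝ} (hφ : MemLp φ ⊤ (volume.restrict R)) :
    MemLp (fun p : Space d × Dir d => φ p.1) ⊤ (phaseMeasure R) :=
  hφ.comp_fst (dirMeasure d)

/-- Multiplication by an essentially bounded function of the position. -/
noncomputable def mulOp (R : Set (Space d)) (φ : Space d → ℝ)
    (hφ : MemLp φ ⊤ (volume.restrict R)) : V0 R →L[ℝ] V0 R :=
  (ContinuousLinearMap.mul ℝ ℝ).holderL (phaseMeasure R) ⊤ 2 2 (memLp_top_comp_fst hφ).toLp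

variable {φ ψ : Space d → ℝ} {hφ : MemLp φ ⊤ (volume.restrict R)}
  {hψ : MemLp ψ ⊤ (volume.restrict R)}

theorem coeFn_mulOp (u : V0 R) :
    mulOp R φ hφ u =ᵐ[phaseMeasure R] fun p => φ p.1 * u p := by
  filter_upwards [(ContinuousLinearMap.mul ℝ ℝ).coeFn_holder (r := 2)
    (memLp_top_comp_fst hφ).toLp u, (memLp_top_comp_fst hφ).coeFn_toLp] with p h1 h2
  refine h1.trans ?_
  rw [h2]
  rfl

theorem inner_mulOp (u v : V0 R) :
    inner ℝ (mulOp R φ hφ u) v = ∫ p, φ p.1 * u p * v p ∂(phaseMeasure R) := by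
  rw [inner_eq_integral_mul]
  refine integral_congr_ae ?_
  filter_upwards [coeFn_mulOp (hφ := hφ) u] with p hp
  rw [hp]

theorem inner_mulOp_right (u v : V0 R) :
    inner ℝ u (mulOp R φ hφ v) = inner ℝ (mulOp R φ hφ u) v := by
  rw [real_inner_comm, inner_mulOp, inner_mulOp]
  exact integral_congr_ae (ae_of_all _ fun p => by ring)

theorem mulOp_reflOp (u : V0 R) :
    mulOp R φ hφ (reflOp R u) = reflOp R (mulOp R φ hφ u) := by
  refine Lp.ext ?_
  filter_upwards [coeFn_mulOp (hφ := hφ) (reflOp R u), coeFn_reflOp u,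
    coeFn_reflOp (mulOp R φ hφ u), (measurePreserving_reflect R).quasiMeasurePreserving.ae_eq_comp
      (coeFn_mulOp (hφ := hφ) u)] with p h1 h2 h3 h4
  rw [h1, h2, h3, h4]
  rfl

theorem mulOp_mulOp_eq_self (h : ∀ᵐ r ∂(volume.restrict R), φ r * ψ r = 1) (u : V0 R) :
    mulOp R φ hφ (mulOp R ψ hψ u) = u := by
  refine Lp.ext ?_
  filter_upwards [coeFn_mulOp (hφ := hφ) (mulOp R ψ hψ u), coeFn_mulOp (hφ := hψ) u,
    ae_phaseMeasure_of_ae h] with p h1 h2 h3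
  rw [h1, h2, ← mul_assoc, h3, one_mul]

theorem norm_mulOp_sq (u : V0 R) :
    ‖mulOp R φ hφ u‖ ^ 2 = ∫ p, (φ p.1 * u p) ^ 2 ∂(phaseMeasure R) := by
  rw [← real_inner_self_eq_norm_sq, inner_eq_integral_mul]
  refine integral_congr_ae ?_
  filter_upwards [coeFn_mulOp (hφ := hφ) u] with p hp
  rw [hp]
  ring

theorem integrable_mul_mul (hφ : MemLp φ ⊤ (volume.restrict R)) (u v : V0 R) :
    Integrable (fun p => φ p.1 * u p * v p) (phaseMeasure R) := by
  refine ((Lp.memLp (mulOp R φ hφ u)).integrable_mul (Lp.memLp v)).congr ?_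
  filter_upwards [coeFn_mulOp (hφ := hφ) u] with p hp
  rw [Pi.mul_apply, hp]

/-- Multiplication operators are monotone in the multiplier, with a gap. -/
theorem inner_mulOp_add_le {c : ℝ} (h : ∀ᵐ r ∂(volume.restrict R), ψ r + c ≤ φ r) (u : V0 R) :
    inner ℝ (mulOp R ψ hψ u) u + c * ‖u‖ ^ 2 ≤ inner ℝ (mulOp R φ hφ u) u := by
  have hu : Integrable (fun p => u p * u p) (phaseMeasure R) :=
    (Lp.memLp u).integrable_mul (Lp.memLp u)
  rw [inner_mulOp, inner_mulOp, ← real_inner_self_eq_norm_sq, inner_eq_integral_mul,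
    ← integral_const_mul, ← integral_add (integrable_mul_mul hψ u u) (hu.const_mul c)]
  refine integral_mono_ae ((integrable_mul_mul hψ u u).add (hu.const_mul c))
    (integrable_mul_mul hφ u u) ?_
  filter_upwards [ae_phaseMeasure_of_ae h] with p hp
  have := mul_le_mul_of_nonneg_right hp (mul_self_nonneg (u p))
  linarith

theorem le_inner_mulOp {c : ℝ} (h : ∀ᵐ r ∂(volume.restrict R), c ≤ φ r) (u : V0 R) :
    c * ‖u‖ ^ 2 ≤ inner ℝ (mulOp R φ hφ u) u := by
  have h0 : MemLp (fun _ : Space d => (0 : ℝ)) ⊤ (volume.restrict R) := MemLp.zero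
  have := inner_mulOp_add_le (hψ := h0) (hφ := hφ) (c := c) (by simpa using h) u
  rw [inner_mulOp] at this
  simpa using this

/-! ### The forms as inner products -/

theorem memLp_top_sqrt {φ : Space d → ℝ} (hφ : MemLp φ ⊤ (volume.restrict R)) :
    MemLp (fun r => Real.sqrt (φ r)) ⊤ (volume.restrict R) := by
  refine ((memLp_top_const (1 : ℝ)).add hφ.norm).of_le
    (Real.continuous_sqrt.comp_aestronglyMeasurable hφ.1) (ae_of_all _ fun r => ?_)
  have h1 : Real.sqrt (φ r) ≤ 1 + |φ r| := by
    rw [Real.sqrt_le_left (by positivity)]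
    nlinarith [le_abs_self (φ r), abs_nonneg (φ r)]
  rw [Real.norm_of_nonneg (Real.sqrt_nonneg _)]
  exact h1.trans (le_abs_self _)

/-- The weighted norm is the `L²` norm after multiplication with `√σ_t`. -/
theorem wNorm_sq (σt : Space d → ℝ) (hσ : MemLp (fun r => Real.sqrt (σt r)) ⊤ (volume.restrict R))
    (v : V0 R) : wNorm R σt v ^ 2 = ‖mulOp R _ hσ v‖ ^ 2 := by
  rw [wNorm, norm_mulOp_sq, Real.sq_sqrt (integral_nonneg fun p => sq_nonneg _)]

/-- On `W` the form `t` is the abstract mixed form, evaluated at the triples of `u⁺` and `v⁺`. -/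
theorem tForm_eq (hRo : IsOpen R) (hRb : Bornology.IsBounded R)
    [IsFiniteMeasure (surfaceMeasure R)] {σt : Space d → ℝ}
    (hσ : MemLp σt ⊤ (volume.restrict R)) {u v : V0 R} {x y : Triple (V0 R) (L2Bdry R)}
    (hx : x ∈ evenGraph hRo hRb) (hxu : x.fst = evenPart (reflOp R) u)
    (hy : y ∈ evenGraph hRo hRb) (hyv : y.fst = evenPart (reflOp R) v) :
    tForm R σt u v = inner ℝ x.snd.fst (oddPart (reflOp R) v)
      - inner ℝ (oddPart (reflOp R) u) y.snd.fst + inner ℝ (mulOp R σt hσ u) v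
      + inner ℝ x.snd.snd y.snd.snd := by
  obtain ⟨hx1, hx2⟩ := sGrad_trace_even_eq hRo hRb hx hxu
  obtain ⟨hy1, hy2⟩ := sGrad_trace_even_eq hRo hRb hy hyv
  rw [tForm, hx1, hx2, hy1, hy2, inner_mulOp]
  congr 1
  · congr 2
    · rw [inner_eq_integral_mul]
      refine integral_congr_ae ?_
      filter_upwards [coeFn_oddPart v] with p hp
      rw [hp]
    · rw [inner_eq_integral_mul]
      refine integral_congr_ae ?_
      filter_upwards [coeFn_oddPart u] with p hp
      rw [hp]
  · rw [inner_eq_integral_mul, integral_wBdryMeasure]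
    simp only [mul_assoc]

theorem measurableSet_inflow (R : Set (Space d)) : MeasurableSet (inflow R) :=
  (isClosed_frontier.measurableSet.preimage measurable_fst).inter
    (measurableSet_lt (measurable_sn R) measurable_const)

/-- On the inflow boundary `-s ⋅ n = |s ⋅ n|`, so the boundary part of `ℓ` is represented in
`L²(∂D; |s ⋅ n|)` by the extension of `2 q_∂` by zero. -/
theorem exists_ell_eq (q : V0 R) (qb : L2Inflow R) :
    ∃ b : L2Bdry R, ∀ v : V0 R, ell R q qb v = inner ℝ q v + inner ℝ b (trace R (even v)) := by
  have hb : MemLp ((inflow R).indicator fun p => 2 * qb p) 2 (wBdryMeasure R) :=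
    (memLp_indicator_iff_restrict (measurableSet_inflow R)).2 ((Lp.memLp qb).const_mul 2)
  refine ⟨hb.toLp, fun v => ?_⟩
  rw [ell, inner_eq_integral_mul, inner_toLp_eq_integral, integral_wBdryMeasure,
    ← integral_indicator (measurableSet_inflow R), sub_eq_add_neg, ← integral_const_mul,
    ← integral_neg]
  congr 2 with p
  by_cases hp : p ∈ inflow R
  · rw [indicator_of_mem hp, indicator_of_mem hp, abs_of_neg hp.2]
    ring
  · rw [indicator_of_notMem hp, indicator_of_notMem hp]
    ring

/-! ### The scattering operator -/

instance sFinite_phaseMeasure (R : Set (Space d)) : SFinite (phaseMeasure R) :=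
  Measure.prod.instSFinite

/-- The measure `θ(s ⋅ s') dr ds ds'` of scattering events, on points `((r, s), s')`. -/
noncomputable def scatMeasure (R : Set (Space d)) (θ : ℝ → ℝ) :
    Measure ((Space d × Dir d) × Dir d) :=
  ((phaseMeasure R).prod (dirMeasure d)).withDensity fun z =>
    ENNReal.ofReal (θ (inner ℝ (z.1.2 : Space d) (z.2 : Space d)))

/-- Exchange of the incoming and the outgoing direction. -/
noncomputable def exchange (z : (Space d × Dir d) × Dir d) : (Space d × Dir d) × Dir d :=
  ((z.1.1, z.2), z.1.2)

theorem theta_inner_nonneg {θ : ℝ → ℝ} (hθ : ∀ x ∈ Set.Icc (-1 : ℝ) 1, 0 ≤ θ x) (s s' : Dir d) :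
    0 ≤ θ (inner ℝ (s : Space d) (s' : Space d)) := by
  refine hθ _ (abs_le.1 ((abs_real_inner_le_norm _ _).trans ?_))
  rw [norm_eq_of_mem_sphere, norm_eq_of_mem_sphere, one_mul]

theorem measurable_theta_inner {θ : ℝ → ℝ} (hθ : Measurable θ) :
    Measurable fun z : (Space d × Dir d) × Dir d =>
      θ (inner ℝ (z.1.2 : Space d) (z.2 : Space d)) :=
  hθ.comp ((measurable_subtype_coe.comp (measurable_snd.comp measurable_fst)).inner
    (measurable_subtype_coe.comp measurable_snd))

theorem measurePreserving_exchange_prod (R : Set (Space d)) :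
    MeasurePreserving exchange ((phaseMeasure R).prod (dirMeasure d))
      ((phaseMeasure R).prod (dirMeasure d)) := by
  have h1 := measurePreserving_prodAssoc (volume.restrict R) (dirMeasure d) (dirMeasure d)
  have h2 : MeasurePreserving (Prod.map id Prod.swap)
      ((volume.restrict R).prod ((dirMeasure d).prod (dirMeasure d)))
      ((volume.restrict R).prod ((dirMeasure d).prod (dirMeasure d))) :=
    (MeasurePreserving.id _).prod Measure.measurePreserving_swap
  exact (h1.symm _).comp (h2.comp h1)

theorem measurePreserving_exchange (R : Set (Space d)) {θ : ℝ → ℝ} (hθ : Measurable θ) :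
    MeasurePreserving exchange (scatMeasure R θ) (scatMeasure R θ) := by
  have h := measurePreserving_exchange_prod R
  refine ⟨h.measurable, ?_⟩
  ext A hA
  rw [Measure.map_apply h.measurable hA, scatMeasure, withDensity_apply _ (h.measurable hA),
    withDensity_apply _ hA, ← h.setLIntegral_comp_preimage hA
      (measurable_theta_inner hθ).ennreal_ofReal]
  simp only [exchange, real_inner_comm]

/-- The marginal of the scattering measure is `dr ds` by the normalization of `θ`. -/
theorem measurePreserving_fst_scatMeasure (R : Set (Space d)) {θ : ℝ → ℝ} (hθ : Measurable θ)
    (hθ0 : ∀ x ∈ Set.Icc (-1 : ℝ) 1, 0 ≤ θ x)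
    (hθ1 : ∀ᵐ s : Dir d ∂(dirMeasure d),
      ∫ s', θ (inner ℝ (s : Space d) (s' : Space d)) ∂(dirMeasure d) = 1) :
    MeasurePreserving Prod.fst (scatMeasure R θ) (phaseMeasure R) := by
  refine ⟨measurable_fst, ?_⟩
  ext A hA
  have hmeas := (measurable_theta_inner (d := d) hθ).ennreal_ofReal
  have hone : ∀ᵐ p ∂(phaseMeasure R), ∫⁻ s', ENNReal.ofReal
      (θ (inner ℝ (p.2 : Space d) (s' : Space d))) ∂(dirMeasure d) = 1 := by
    have : ∀ᵐ p ∂(phaseMeasure R),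
        ∫ s', θ (inner ℝ (p.2 : Space d) (s' : Space d)) ∂(dirMeasure d) = 1 :=
      Measure.quasiMeasurePreserving_snd.ae hθ1
    filter_upwards [this] with p hp
    rw [← ofReal_integral_eq_lintegral_ofReal
      (Integrable.of_integral_ne_zero (by rw [hp]; exact one_ne_zero))
      (ae_of_all _ fun s' => theta_inner_nonneg hθ0 _ _), hp, ENNReal.ofReal_one]
  have hpre : (Prod.fst ⁻¹' A : Set ((Space d × Dir d) × Dir d)) = A ×ˢ univ := by ext; simp
  rw [Measure.map_apply measurable_fst hA, scatMeasure,
    withDensity_apply _ (measurable_fst hA), hpre, ← Measure.prod_restrict,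
    lintegral_prod _ hmeas.aemeasurable, Measure.restrict_univ,
    lintegral_congr_ae (ae_restrict_of_ae hone)]
  simp

/-- The scattering form is bounded on `L²(D)` and dominated by multiplication with `σ_s`: both
marginals of the scattering measure are `dr ds`, so that `(Θ u, v)` is the inner product of `u` at
the incoming and `v` at the outgoing direction in its `L²` space. -/
theorem exists_scattering_operator {σs : Space d → ℝ} (hσs : MemLp σs ⊤ (volume.restrict R))
    (hσs0 : ∀ᵐ r ∂(volume.restrict R), 0 < σs r) {θ : ℝ → ℝ} (hθ : Measurable θ)
    (hθ0 : ∀ x ∈ Set.Icc (-1 : ℝ) 1, 0 ≤ θ x)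
    (hθ1 : ∀ᵐ s : Dir d ∂(dirMeasure d),
      ∫ s', θ (inner ℝ (s : Space d) (s' : Space d)) ∂(dirMeasure d) = 1) :
    ∃ K : V0 R →L[ℝ] V0 R, (∀ u v : V0 R, sForm R σs θ u v = inner ℝ (K u) v) ∧
      ∀ u, inner ℝ (K u) u ≤ inner ℝ (mulOp R σs hσs u) u := by
  have hout := measurePreserving_fst_scatMeasure R hθ hθ0 hθ1
  have hin := hout.comp (measurePreserving_exchange R hθ)
  let A : V0 R →ₗᵢ[ℝ] Lp ℝ 2 (scatMeasure R θ) := Lp.compMeasurePreservingₗᵢ ℝ _ hout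
  let B : V0 R →ₗᵢ[ℝ] Lp ℝ 2 (scatMeasure R θ) := Lp.compMeasurePreservingₗᵢ ℝ _ hin
  have hA : ∀ u : V0 R, A u =ᵐ[scatMeasure R θ] fun z => u z.1 := fun u =>
    Lp.coeFn_compMeasurePreserving u hout
  have hB : ∀ u : V0 R, B u =ᵐ[scatMeasure R θ] fun z => u (z.1.1, z.2) := fun u =>
    Lp.coeFn_compMeasurePreserving u hin
  let K : V0 R →L[ℝ] V0 R := mulOp R σs hσs ∘L
    ContinuousLinearMap.adjoint A.toContinuousLinearMap ∘L B.toContinuousLinearMap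
  have hK : ∀ u v, inner ℝ (K u) v = inner ℝ (B u) (A (mulOp R σs hσs v)) := fun u v => by
    change inner ℝ (mulOp R σs hσs (ContinuousLinearMap.adjoint A.toContinuousLinearMap (B u))) v
      = _
    rw [← inner_mulOp_right, ContinuousLinearMap.adjoint_inner_left]
    rfl
  refine ⟨K, fun u v => ?_, fun u => ?_⟩
  · set M := mulOp R σs hσs v with hM
    have hF : Integrable (fun z => u (z.1.1, z.2) * M z.1) (scatMeasure R θ) := by
      refine ((Lp.memLp (B u)).integrable_mul (Lp.memLp (A M))).congr ?_
      filter_upwards [hA M, hB u] with z h1 h2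
      rw [Pi.mul_apply, h1, h2]
    have hmeas := (measurable_theta_inner (d := d) hθ).ennreal_ofReal
    have hF' : Integrable (fun z : (Space d × Dir d) × Dir d =>
        θ (inner ℝ (z.1.2 : Space d) (z.2 : Space d)) * (u (z.1.1, z.2) * M z.1))
        ((phaseMeasure R).prod (dirMeasure d)) := by
      rw [scatMeasure, integrable_withDensity_iff_integrable_smul' hmeas
        (ae_of_all _ fun _ => ENNReal.ofReal_lt_top)] at hF
      simpa only [ENNReal.toReal_ofReal (theta_inner_nonneg hθ0 _ _), smul_eq_mul] using hF
    calc sForm R σs θ u v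
        = ∫ p, Theta θ u p * M p ∂(phaseMeasure R) := by
          refine integral_congr_ae ?_
          filter_upwards [coeFn_mulOp (hφ := hσs) v] with p hp
          rw [hM, hp]
          ring
      _ = ∫ p, ∫ s', θ (inner ℝ (p.2 : Space d) (s' : Space d)) * (u (p.1, s') * M p)
            ∂(dirMeasure d) ∂(phaseMeasure R) := by
          simp only [Theta, ← integral_mul_const, mul_assoc]
      _ = ∫ z : (Space d × Dir d) × Dir d,
            θ (inner ℝ (z.1.2 : Space d) (z.2 : Space d)) * (u (z.1.1, z.2) * M z.1)
            ∂((phaseMeasure R).prod (dirMeasure d)) := (integral_prod _ hF').symm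
      _ = ∫ z, u (z.1.1, z.2) * M z.1 ∂(scatMeasure R θ) := by
          rw [scatMeasure, integral_withDensity_eq_integral_toReal_smul hmeas
            (ae_of_all _ fun _ => ENNReal.ofReal_lt_top)]
          simp only [ENNReal.toReal_ofReal (theta_inner_nonneg hθ0 _ _), smul_eq_mul]
      _ = inner ℝ (K u) v := by
          rw [hK, inner_eq_integral_mul]
          refine integral_congr_ae ?_
          filter_upwards [hA M, hB u] with z h1 h2
          rw [h1, h2]
  · -- distribute `σ_s`, which depends on the position only, over both factors
    have hsq := memLp_top_sqrt hσs
    have h1 : inner ℝ (K u) u = inner ℝ (B (mulOp R _ hsq u)) (A (mulOp R _ hsq u)) := by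
      rw [hK, inner_eq_integral_mul, inner_eq_integral_mul]
      refine integral_congr_ae ?_
      filter_upwards [hA (mulOp R σs hσs u), hB u, hA (mulOp R _ hsq u), hB (mulOp R _ hsq u),
        hout.quasiMeasurePreserving.ae_eq_comp (coeFn_mulOp (hφ := hσs) u),
        hout.quasiMeasurePreserving.ae_eq_comp (coeFn_mulOp (hφ := hsq) u),
        hin.quasiMeasurePreserving.ae_eq_comp (coeFn_mulOp (hφ := hsq) u),
        hout.quasiMeasurePreserving.ae (ae_phaseMeasure_of_ae hσs0)]
        with z e1 e2 e3 e4 e5 e6 e7 e8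
      simp only [Function.comp_apply, exchange] at e5 e6 e7 e8
      rw [e1, e2, e3, e4, e5, e6, e7]
      have := Real.mul_self_sqrt e8.le
      linear_combination (-(u (z.1.1, z.2) * u z.1)) * this
    have h2 : inner ℝ (mulOp R σs hσs u) u = ‖mulOp R _ hsq u‖ ^ 2 := by
      rw [norm_mulOp_sq, inner_mulOp]
      refine integral_congr_ae ?_
      filter_upwards [ae_phaseMeasure_of_ae hσs0] with p hp
      rw [mul_pow, Real.sq_sqrt hp.le]
      ring
    rw [h1, h2]
    refine (real_inner_le_norm _ _).trans ?_
    rw [A.norm_map, B.norm_map, sq]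

/-! ### The transport problem -/

theorem add_mem_evenGraph_of_eq_evenPart (hRo : IsOpen R) (hRb : Bornology.IsBounded R)
    [IsFiniteMeasure (surfaceMeasure R)] {u v : V0 R} {x y : Triple (V0 R) (L2Bdry R)}
    (hx : x ∈ evenGraph hRo hRb) (hxu : x.fst = evenPart (reflOp R) u)
    (hy : y ∈ evenGraph hRo hRb) (hyv : y.fst = evenPart (reflOp R) v) :
    x + y ∈ evenGraph hRo hRb ∧ (x + y).fst = evenPart (reflOp R) (u + v) := by
  refine ⟨Submodule.add_mem _ hx hy, ?_⟩
  rw [WithLp.add_fst, hxu, hyv]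
  simp only [evenPart, map_add]
  module

theorem W_add (hRo : IsOpen R) (hRb : Bornology.IsBounded R)
    [IsFiniteMeasure (surfaceMeasure R)] {u v : V0 R} (hu : u ∈ W R) (hv : v ∈ W R) :
    u + v ∈ W R := by
  rw [mem_W_iff hRo hRb] at hu hv ⊢
  obtain ⟨x, hx, hxu⟩ := hu
  obtain ⟨y, hy, hyv⟩ := hv
  exact ⟨x + y, add_mem_evenGraph_of_eq_evenPart hRo hRb hx hxu hy hyv⟩

theorem W_neg (hRo : IsOpen R) (hRb : Bornology.IsBounded R)
    [IsFiniteMeasure (surfaceMeasure R)] {u : V0 R} (hu : u ∈ W R) : -u ∈ W R := by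
  rw [mem_W_iff hRo hRb] at hu ⊢
  obtain ⟨x, hx, hxu⟩ := hu
  refine ⟨-x, Submodule.neg_mem _ hx, ?_⟩
  rw [WithLp.neg_fst, hxu]
  simp only [evenPart, map_neg]
  module

theorem tForm_add (hRo : IsOpen R) (hRb : Bornology.IsBounded R)
    [IsFiniteMeasure (surfaceMeasure R)] {σt : Space d → ℝ}
    (hσ : MemLp σt ⊤ (volume.restrict R)) {u u' v : V0 R} (hu : u ∈ W R) (hu' : u' ∈ W R)
    (hv : v ∈ W R) : tForm R σt (u + u') v = tForm R σt u v + tForm R σt u' v := by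
  rw [mem_W_iff hRo hRb] at hu hu' hv
  obtain ⟨x, hx, hxu⟩ := hu
  obtain ⟨x', hx', hxu'⟩ := hu'
  obtain ⟨y, hy, hyv⟩ := hv
  obtain ⟨h1, h2⟩ := add_mem_evenGraph_of_eq_evenPart hRo hRb hx hxu hx' hxu'
  have ho : oddPart (reflOp R) (u + u') = oddPart (reflOp R) u + oddPart (reflOp R) u' := by
    simp only [oddPart, map_add]
    module
  rw [tForm_eq hRo hRb hσ h1 h2 hy hyv, tForm_eq hRo hRb hσ hx hxu hy hyv,
    tForm_eq hRo hRb hσ hx' hxu' hy hyv, ho]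
  simp only [WithLp.add_fst, WithLp.add_snd, inner_add_left, map_add]
  ring

/-- The concrete transport problem is an instance of the abstract variational problem. -/
theorem solves_iff (hRo : IsOpen R) (hRb : Bornology.IsBounded R)
    [IsFiniteMeasure (surfaceMeasure R)] {σt : Space d → ℝ}
    (hσ : MemLp σt ⊤ (volume.restrict R)) (a : V0 R) (b : L2Bdry R) (u : V0 R) :
    Solves (reflOp R) (mulOp R σt hσ) (evenGraph hRo hRb) a b u ↔
      u ∈ W R ∧ ∀ v ∈ W R, tForm R σt u v = inner ℝ a v + inner ℝ b (trace R (even v)) := by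
  constructor
  · rintro ⟨x, hx, hxu, h⟩
    refine ⟨(mem_W_iff hRo hRb u).2 ⟨x, hx, hxu⟩, fun v hv => ?_⟩
    obtain ⟨y, hy, hyv⟩ := (mem_W_iff hRo hRb v).1 hv
    rw [tForm_eq hRo hRb hσ hx hxu hy hyv, h y hy v hyv,
      (sGrad_trace_even_eq hRo hRb hy hyv).2]
  · rintro ⟨hu, h⟩
    obtain ⟨x, hx, hxu⟩ := (mem_W_iff hRo hRb u).1 hu
    refine ⟨x, hx, hxu, fun y hy v hyv => ?_⟩
    rw [← tForm_eq hRo hRb hσ hx hxu hy hyv, h v ((mem_W_iff hRo hRb v).2 ⟨y, hy, hyv⟩),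
      (sGrad_trace_even_eq hRo hRb hy hyv).2]

/-- The multiplier `σ_t` and its inverse are bounded and bounded below, as the elimination of the
odd part requires. -/
theorem exists_solves_transport (hRo : IsOpen R) (hRb : Bornology.IsBounded R)
    [IsFiniteMeasure (surfaceMeasure R)] {σt : Space d → ℝ}
    (hσ : MemLp σt ⊤ (volume.restrict R)) {c₀ : ℝ} (hc₀ : 0 < c₀)
    (hσ0 : ∀ᵐ r ∂(volume.restrict R), c₀ ≤ σt r) (a : V0 R) (b : L2Bdry R) :
    ∃ u, Solves (reflOp R) (mulOp R σt hσ) (evenGraph hRo hRb) a b u := by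
  obtain ⟨M, hM0, hM⟩ : ∃ M > 0, ∀ᵐ r ∂(volume.restrict R), σt r ≤ M := by
    refine ⟨max 1 (eLpNorm σt ⊤ (volume.restrict R)).toReal, by positivity, ?_⟩
    have := ae_le_eLpNormEssSup (f := σt) (μ := volume.restrict R)
    filter_upwards [this] with r hr
    refine (le_abs_self _).trans (le_trans ?_ (le_max_right _ _))
    rw [eLpNorm_exponent_top]
    have h2 := ENNReal.toReal_mono (by simpa using hσ.2.ne) hr
    simpa using h2
  have hinv : MemLp (fun r => (σt r)⁻¹) ⊤ (volume.restrict R) := by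
    refine memLp_top_of_bound hσ.1.aemeasurable.inv.aestronglyMeasurable c₀⁻¹ ?_
    filter_upwards [hσ0] with r hr
    rw [norm_inv, Real.norm_of_nonneg (hc₀.le.trans hr)]
    exact inv_anti₀ hc₀ hr
  refine exists_solves (isClosed_evenGraph hRo hRb) reflOp_reflOp inner_reflOp_left
    (fun x hx => mem_evenGraph_parity hRo hRb hx) (mulOp R _ hinv) hc₀ (inv_pos.2 hM0)
    (le_inner_mulOp hσ0) (le_inner_mulOp ?_) (mulOp_mulOp_eq_self ?_) mulOp_reflOp mulOp_reflOp a b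
  · filter_upwards [hσ0, hM] with r h1 h2
    exact inv_anti₀ (hc₀.trans_le h1) h2
  · filter_upwards [hσ0] with r h1
    exact mul_inv_cancel₀ (hc₀.trans_le h1).ne'

end RadiativeTransfer

open RadiativeTransfer in
theorem mainTheorem5 (d : ℕ) (hd : 1 ≤ d)
    (R : Set (RadiativeTransfer.Space d)) (hRo : IsOpen R) (hRb : Bornology.IsBounded R)
    (hRL : RadiativeTransfer.HasLipschitzBoundary R)
    (σs σa σt : RadiativeTransfer.Space d → ℝ) (hσt : ∀ r, σt r = σa r + σs r)
    (hσs_pos : ∀ᵐ r ∂(volume.restrict R), 0 < σs r)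
    (hσs_bdd : MemLp σs ∞ (volume.restrict R))
    (hσt_bdd : MemLp σt ∞ (volume.restrict R))
    (c₀ : ℝ) (hc₀ : 0 < c₀) (hσa : ∀ᵐ r ∂(volume.restrict R), c₀ ≤ σa r)
    (θ : ℝ → ℝ) (hθ_meas : Measurable θ) (hθ_nonneg : ∀ x ∈ Set.Icc (-1 : ℝ) 1, 0 ≤ θ x)
    (hθ_one : ∀ᵐ s : RadiativeTransfer.Dir d ∂(RadiativeTransfer.dirMeasure d),
      ∫ s', θ (inner ℝ (s : RadiativeTransfer.Space d) (s' : RadiativeTransfer.Space d))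
        ∂(RadiativeTransfer.dirMeasure d) = 1)
    (q : RadiativeTransfer.V0 R) (qb : RadiativeTransfer.L2Inflow R)
    (WN : Submodule ℝ (RadiativeTransfer.V0 R)) (hWN_fin : FiniteDimensional ℝ WN)
    (hWN : ∀ w ∈ WN, w ∈ RadiativeTransfer.W R) :
    -- the preconditioned residual operator is well defined on `W`
    (∀ w ∈ RadiativeTransfer.W R, ∃! r,
      RadiativeTransfer.IsPrecResidual R σs σt θ q qb w r) ∧
    -- the half-step iterate is well defined
    (∀ u ∈ RadiativeTransfer.W R, ∃! u',
      RadiativeTransfer.IsHalfStep R σs σt θ q qb u u') ∧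
    -- the minimization problem has a unique solution, whatever element of `W`
    -- (in particular, any half-step iterate) is to be corrected
    (∀ u' ∈ RadiativeTransfer.W R, ∃! w, w ∈ WN ∧ ∀ v ∈ WN,
      RadiativeTransfer.wNorm R σt
          (RadiativeTransfer.precResidual R σs σt θ q qb (u' + w)) ^ 2 ≤
        RadiativeTransfer.wNorm R σt
          (RadiativeTransfer.precResidual R σs σt θ q qb (u' + v)) ^ 2) := by
  have hσt0 : ∀ᵐ r ∂(volume.restrict R), σs r + c₀ ≤ σt r := by
    filter_upwards [hσa] with r hr
    rw [hσt]
    linarith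
  have hσt1 : ∀ᵐ r ∂(volume.restrict R), c₀ ≤ σt r := by
    filter_upwards [hσt0, hσs_pos] with r h1 h2
    linarith
  have := isFiniteMeasure_surfaceMeasure hRo hRb hRL
  obtain ⟨K, hK, hKle⟩ := exists_scattering_operator hσs_bdd hσs_pos hθ_meas hθ_nonneg hθ_one
  obtain ⟨b, hb⟩ := exists_ell_eq q qb
  have hS := le_inner_mulOp (R := R) (hφ := hσt_bdd) hσt1
  have hex := exists_solves_transport hRo hRb hσt_bdd hc₀ hσt1
  have hiff := solves_iff hRo hRb hσt_bdd
  -- a half step is a transport solve with the scattered field as additional source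
  have half : ∀ u u', IsHalfStep R σs σt θ q qb u u' ↔
      Solves (reflOp R) (mulOp R σt hσt_bdd) (evenGraph hRo hRb) (K u + q) b u' := by
    intro u u'
    rw [hiff, IsHalfStep]
    simp only [hb, hK, inner_add_left, add_assoc]
  -- likewise `w + R(w)` solves the transport problem of the half step from `w`
  have prec : ∀ w ∈ W R, ∀ r, IsPrecResidual R σs σt θ q qb w r ↔
      Solves (reflOp R) (mulOp R σt hσt_bdd) (evenGraph hRo hRb) (K w + q) b (r + w) := by
    intro w hw r
    rw [← half, IsHalfStep, IsPrecResidual]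
    have hr : r + w ∈ W R ↔ r ∈ W R :=
      ⟨fun h => by simpa using W_add hRo hRb h (W_neg hRo hRb hw), fun h => W_add hRo hRb h hw⟩
    rw [hr]
    refine and_congr_right fun hr => forall₂_congr fun v hv => ?_
    rw [tForm_add hRo hRb hσt_bdd hr hw hv, RadiativeTransfer.residual]
    constructor <;> intro h <;> linarith
  have hprec : ∀ w ∈ W R, ∃! r, IsPrecResidual R σs σt θ q qb w r := by
    intro w hw
    obtain ⟨u, hu⟩ := hex (K w + q) b
    refine ⟨u - w, (prec w hw _).2 (by rwa [sub_add_cancel]), fun r hr => ?_⟩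
    rw [((prec w hw r).1 hr).unique hc₀ hS hu |>.symm, add_sub_cancel_right]
  refine ⟨hprec, fun u _ => ?_, fun u' hu' => ?_⟩
  · obtain ⟨u', hu'⟩ := hex (K u + q) b
    exact ⟨u', (half u u').2 hu', fun z hz => ((half u z).1 hz).unique hc₀ hS hu'⟩
  · obtain ⟨L, hL⟩ := exists_linearMap_solves hc₀ hS fun a => hex a 0
    have hspec : ∀ w ∈ W R, Solves (reflOp R) (mulOp R σt hσt_bdd) (evenGraph hRo hRb)
        (K w + q) b (precResidual R σs σt θ q qb w + w) := fun w hw => by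
      have h := (hprec w hw).exists
      rw [precResidual, dif_pos h]
      exact (prec w hw _).1 h.choose_spec
    -- the residual operator is affine, with linear part `w ↦ L (K w) - w`
    have haff : ∀ w ∈ WN, precResidual R σs σt θ q qb (u' + w)
        = precResidual R σs σt θ q qb u' + (L (K w) - w) := by
      intro w hw
      have h1 := (hspec u' hu').add (hL (K w))
      have h2 := hspec (u' + w) (W_add hRo hRb hu' (hWN w hw))
      rw [map_add, add_right_comm] at h2
      rw [add_zero, add_right_comm] at h1
      have h3 := h2.unique hc₀ hS (by convert h1 using 1; abel)
      rw [← sub_eq_zero] at h3 ⊢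
      rw [← h3]
      abel
    have hsq := memLp_top_sqrt hσt_bdd
    have hQ : ∀ v : V0 R, c₀ * ‖v‖ ^ 2 ≤ ‖mulOp R _ hsq v‖ ^ 2 := fun v => by
      refine (hS v).trans_eq ?_
      rw [norm_mulOp_sq, inner_mulOp]
      refine integral_congr_ae ?_
      filter_upwards [ae_phaseMeasure_of_ae hσt1] with p hp
      rw [mul_pow, Real.sq_sqrt (hc₀.le.trans hp)]
      ring
    let T : WN →ₗ[ℝ] V0 R := (mulOp R _ hsq).toLinearMap ∘ₗ
      (L ∘ₗ K.toLinearMap - LinearMap.id) ∘ₗ WN.subtype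
    have hT : ∀ w : WN, T w = mulOp R _ hsq (L (K w) - w) := fun w => rfl
    have hTinj : Function.Injective T := by
      rw [injective_iff_map_eq_zero]
      intro w hw
      have h1 := hQ (L (K w) - w)
      rw [← hT, hw, norm_zero] at h1
      have h2 : ‖L (K w) - w‖ ^ 2 = 0 := le_antisymm (by nlinarith) (sq_nonneg _)
      have h3 : L (K w) = w := sub_eq_zero.1 (by simpa using h2)
      -- hence `w` solves the homogeneous transport equation with scattering
      have h4 := (h3 ▸ hL (K w)).inner_self_le
      have h5 := inner_mulOp_add_le (hψ := hσs_bdd) (hφ := hσt_bdd) hσt0 (w : V0 R)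
      have h6 : ‖(w : V0 R)‖ ^ 2 = 0 :=
        le_antisymm (by nlinarith [hKle (w : V0 R)]) (sq_nonneg _)
      simpa using h6
    obtain ⟨w, hw, huniq⟩ := existsUnique_forall_norm_add_le T hTinj
      (mulOp R _ hsq (precResidual R σs σt θ q qb u'))
    have hval : ∀ w : WN, wNorm R σt (precResidual R σs σt θ q qb (u' + w)) ^ 2
        = ‖mulOp R _ hsq (precResidual R σs σt θ q qb u') + T w‖ ^ 2 := fun w => by
      rw [wNorm_sq σt hsq, haff w w.2, map_add, hT]
    refine ⟨w, ⟨w.2, fun v hv => ?_⟩, fun z ⟨hz, hmin⟩ => ?_⟩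
    · rw [hval w, hval ⟨v, hv⟩]
      exact hw ⟨v, hv⟩
    · refine congrArg Subtype.val (huniq ⟨z, hz⟩ fun v => ?_)
      rw [← hval, ← hval]
      exact hmin v v.2
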